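/- **Setting.** A binary-input output-symmetric channel has inputs $x\in\{\pm1\}$, outputs $y\in\mathbb R$ and transition law $p(y\mid x)$ with $p(-y\mid -x)=p(y\mid x)$ (laws with atoms are allowed). Its half-loglikelihood is $l(y)=\frac12\ln\frac{p(y\mid+1)}{p(y\mid-1)}$, and $c(l)\,dl$ denotes the law of $l(y)$ when $y\sim p(\cdot\mid+1)$. A family of such channels, indexed by a noise parameter $\epsilon\in(0,\epsilon_{\max})$ with $0<\epsilon_{\max}\le+\infty$, belongs to the class $\mathcal K$ if, with $l\sim c_\epsilon(l)\,dl$ almost surely finite: 1. for each $\epsilon\in(0,\epsilon_{\max})$ the derivatives $T_{2p}(\epsilon)=\frac{d}{d\epsilon}\int c_\epsilon(l)(\tanh l)^{2p}\,dl$ exist and are bounded uniformly in the integers $p\ge1$; 2. $\mathbb E[e^{m|l|}]<\infty$ for each $\epsilon\in(0,\epsilon_{\max})$ and each $m>0$; 3. (low noise) there is $s_0>0$ such that $\lim_{\epsilon\to0}\mathbb E[e^{-sl}]=0$ for all $0<s\le s_0$; 4. (high noise) there is $H(\epsilon)>0$ with $\lim_{\epsilon\to\epsilon_{\max}}\bigl(e^{4H(\epsilon)}-1+\mathbb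 P(|l|>H(\epsilon))\bigr)=0$. A code is given by a finite bipartite graph with variable nodes and check nodes; $\partial v$ denotes the set of neighbours of a node $v$. All variable nodes have degree at most $l_{\max}$ and all check nodes have degree at most $k_{\max}$. The distance $\mathrm{dist}$ is the distance in this bipartite graph, $+\infty$ between different connected components. * *LDGM code*: information bits $u\in\{\pm1\}^m$ sit at the variable nodes, and the $n$ code-bits $x_i=\prod_{a\in\partial i}u_a$ at the check nodes; $\langle\cdot\rangle$ is the average over $u$ with weight proportional to $\prod_{i=1}^n e^{l_ix_i}$. * *LDPC code*: the code-bits $x\in\{\pm1\}^n$ sit at the variable nodes; $\langle\cdot\rangle$ is the average over $x$ with weight proportional to $\prod_{c=1}^m\frac12\bigl(1+\prod_{i\in\partial c}x_i\bigr)\prod_{i=1}^n e^{l_ix_i}$. In both cases this is the posterior (MAP) measure given the received word. $\mathbb E_{l^n}$ denotes the average over i.i.d. $l_1,\dots,l_n$ with law $c_\epsilon(l)\,dl$ (transmission of the all-one codeword). **Theorem (decay of correlations for the MAP decoder).** There is a numerical constant $c_1>0$ such that, for every family of channels in $\mathcal K$ and all integers $l_{\max},k_{\max}\ge 0$, the following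 two statements hold. (LDGM, high noise) There are $0<\epsilon_g<\epsilon_{\max}$ and a function $\xi>0$ on $(\epsilon_g,\epsilon_{\max})$, both depending only on the channel family, $l_{\max}$ and $k_{\max}$, such that $\xi^{-1}$ is non-decreasing and $\xi^{-1}(\epsilon)\to+\infty$ as $\epsilon\to\epsilon_{\max}$, and such that for all $\epsilon_g<\epsilon<\epsilon_{\max}$, all $n,m$, all LDGM codes as above and all code-bits $i,j$, $$\mathbb E_{l^n}\bigl[|\langle x_ix_j\rangle-\langle x_i\rangle\langle x_j\rangle|\bigr]\le c_1e^{-\mathrm{dist}(i,j)/\xi(\epsilon)},$$ except that, for two distinct check nodes $i\ne j$ with $\partial i=\partial j$ (so that $x_i=x_j$ identically), $\xi(\epsilon)$ is replaced by $\max\{\xi(\epsilon),1\}$ in this bound. (LDPC, low noise) There are $0<\epsilon_p<\epsilon_{\max}$ and a function $\xi>0$ on $(0,\epsilon_p)$, both depending only on the channel family, $l_{\max}$ and $k_{\max}$, such that $\xi^{-1}$ is non-increasing and $\xi^{-1}(\epsilon)\to+\infty$ as $\epsilon\to0$, and such that for all $0<\epsilon<\epsilon_p$, all $n,m$, all LDPC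 codes as above and all code-bits $i,j$, $$\mathbb E_{l^n}\bigl[|\langle x_ix_j\rangle-\langle x_i\rangle\langle x_j\rangle|\bigr]\le c_1e^{-\mathrm{dist}(i,j)/\xi(\epsilon)}.$$ -/

import Mathlib

open MeasureTheory Filter Topology

noncomputable section

namespace SparseCode

/-! ### Binary-input memoryless output-symmetric channels -/

/-- A binary-input output-symmetric channel with real outputs: `kernel x` is the law of the output
`Y` when the input is `x ∈ {-1, +1} = ℤˣ`.  Laws that are not absolutely continuous with respect
to Lebesgue measure (as for the binary symmetric channel) are allowed. -/
structure SymmetricChannel where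
  kernel : ℤˣ → Measure ℝ
  isProbabilityMeasure : ∀ x, IsProbabilityMeasure (kernel x)
  symmetric : ∀ x, (kernel x).map (fun y => -y) = kernel (-x)

/-- The half-loglikelihood `l = (1/2) ln (p(y | +1) / p(y | -1))` of an output `y`. -/
def SymmetricChannel.halfLogLikelihood (W : SymmetricChannel) (y : ℝ) : ℝ :=
  (1 / 2) * Real.log ((W.kernel 1).rnDeriv (W.kernel (-1)) y).toReal

/-- The law `c(l) dl` of the half-loglikelihood when the input is `+1`. -/
def SymmetricChannel.llrLaw (W : SymmetricChannel) : Measure ℝ :=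
  (W.kernel 1).map W.halfLogLikelihood

/-- The filter of real noise parameters `ε` that tend to `εmax` from below
(`εmax` may be `+∞`). -/
def towardsMax (εmax : EReal) : Filter ℝ :=
  Filter.comap (fun ε : ℝ => (ε : EReal)) (𝓝[<] εmax)

/-- The class `𝒦` of families of binary-input memoryless output-symmetric channels, indexed by a
noise parameter `ε ∈ (0, εmax)`. -/
structure ClassK (εmax : EReal) (W : ℝ → SymmetricChannel) : Prop where
  εmax_pos : 0 < εmax
  /-- The half-loglikelihood is almost surely finite. -/
  llr_finite : ∀ ε : ℝ, 0 < ε → (ε : EReal) < εmax →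
    (W ε).kernel 1 ≪ (W ε).kernel (-1)
  /-- The numbers `T_{2p}(ε) = d/dε ∫ c(l) (tanh l)^{2p} dl` are bounded uniformly in `p ≥ 1`. -/
  bounded_derivatives : ∀ ε : ℝ, 0 < ε → (ε : EReal) < εmax → ∃ M : ℝ, ∀ p : ℕ, 1 ≤ p →
    DifferentiableAt ℝ (fun e => ∫ l, Real.tanh l ^ (2 * p) ∂(W e).llrLaw) ε ∧
      |deriv (fun e => ∫ l, Real.tanh l ^ (2 * p) ∂(W e).llrLaw) ε| ≤ M
  /-- All exponential moments `E[exp (m |l|)]` are finite. -/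
  exp_moments : ∀ ε : ℝ, 0 < ε → (ε : EReal) < εmax → ∀ m : ℝ, 0 < m →
    Integrable (fun l => Real.exp (m * |l|)) (W ε).llrLaw
  /-- Low noise condition. -/
  low_noise : ∃ s₀ : ℝ, 0 < s₀ ∧ ∀ s : ℝ, 0 < s → s ≤ s₀ →
    Tendsto (fun ε => ∫ l, Real.exp (-s * l) ∂(W ε).llrLaw) (𝓝[>] 0) (𝓝 0)
  /-- High noise condition. -/
  high_noise : ∃ H : ℝ → ℝ, (∀ ε : ℝ, 0 < ε → (ε : EReal) < εmax → 0 < H ε) ∧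
    Tendsto (fun ε => Real.exp (4 * H ε) - 1 + (W ε).llrLaw.real {l | H ε < |l|})
      (towardsMax εmax) (𝓝 0)

/-! ### Codes on bipartite graphs -/

/-- A bipartite graph with variable nodes `V` and check nodes `C`. -/
structure BipartiteGraph (V C : Type) where
  Adj : V → C → Prop

variable {V C : Type}

/-- The set `∂v` of check nodes adjacent to the variable node `v`. -/
def BipartiteGraph.varNbhd [Fintype C] (G : BipartiteGraph V C) (v : V) : Finset C :=
  open Classical in Finset.univ.filter (fun c => G.Adj v c)

/-- The set `∂c` of variable nodes adjacent to the check node `c`. -/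
def BipartiteGraph.checkNbhd [Fintype V] (G : BipartiteGraph V C) (c : C) : Finset V :=
  open Classical in Finset.univ.filter (fun v => G.Adj v c)

/-- Variable nodes have degree at most `lmax` and check nodes have degree at most `kmax`. -/
def BipartiteGraph.DegreesBounded [Fintype V] [Fintype C] (G : BipartiteGraph V C)
    (lmax kmax : ℕ) : Prop :=
  (∀ v, (G.varNbhd v).card ≤ lmax) ∧ (∀ c, (G.checkNbhd c).card ≤ kmax)

/-- The bipartite graph as a simple graph on the disjoint union of its two node sets. -/
def BipartiteGraph.tannerGraph (G : BipartiteGraph V C) : SimpleGraph (V ⊕ C) :=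
  SimpleGraph.fromRel (fun p q => ∃ v c, p = Sum.inl v ∧ q = Sum.inr c ∧ G.Adj v c)

/-- A spin `±1` as a real number. -/
def spin (x : ℤˣ) : ℝ := ((x : ℤ) : ℝ)

/-- The Gibbs average `⟨f⟩` with respect to the weight `w` on a finite configuration space. -/
def gibbs {Ω : Type} [Fintype Ω] (w f : Ω → ℝ) : ℝ :=
  (∑ ω, f ω * w ω) / ∑ ω, w ω

/-- The covariance `⟨f g⟩ - ⟨f⟩ ⟨g⟩` with respect to the weight `w`. -/
def gibbsCov {Ω : Type} [Fintype Ω] (w f g : Ω → ℝ) : ℝ :=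
  gibbs w (fun ω => f ω * g ω) - gibbs w f * gibbs w g

/-- The code-bit `x_i = ∏_{a ∈ ∂i} u_a` of an LDGM code; the information bits `u` sit at the
variable nodes and the code-bits at the check nodes. -/
def ldgmBit [Fintype V] (G : BipartiteGraph V C) (u : V → ℤˣ) (i : C) : ℤˣ :=
  ∏ a ∈ G.checkNbhd i, u a

/-- The unnormalized posterior weight of the information bits of an LDGM code, given the
half-loglikelihoods `l`. -/
def ldgmWeight [Fintype V] [Fintype C] (G : BipartiteGraph V C) (l : C → ℝ) (u : V → ℤˣ) : ℝ :=
  ∏ i, Real.exp (l i * spin (ldgmBit G u i))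

/-- The unnormalized posterior weight of the code-bits of an LDPC code, given the
half-loglikelihoods `l`; the code-bits `x` sit at the variable nodes. -/
def ldpcWeight [Fintype V] [Fintype C] (G : BipartiteGraph V C) (l : V → ℝ) (x : V → ℤˣ) : ℝ :=
  (∏ c, (1 / 2 : ℝ) * (1 + ∏ i ∈ G.checkNbhd c, spin (x i))) * ∏ i, Real.exp (l i * spin (x i))

open Classical in
/-- The noise average `E |⟨x_i x_j⟩ - ⟨x_i⟩ ⟨x_j⟩|` for an LDGM code used over the channel `W`;
the half-loglikelihoods of the code-bits are i.i.d. with law `W.llrLaw`. -/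
def ldgmAvgCorr [Fintype V] [Fintype C] (W : SymmetricChannel) (G : BipartiteGraph V C)
    (i j : C) : ℝ :=
  ∫ l : C → ℝ, |gibbsCov (ldgmWeight G l) (fun u => spin (ldgmBit G u i))
    (fun u => spin (ldgmBit G u j))| ∂(Measure.pi fun _ => W.llrLaw)

open Classical in
/-- The noise average `E |⟨x_i x_j⟩ - ⟨x_i⟩ ⟨x_j⟩|` for an LDPC code used over the channel `W`;
the half-loglikelihoods of the code-bits are i.i.d. with law `W.llrLaw`. -/
def ldpcAvgCorr [Fintype V] [Fintype C] (W : SymmetricChannel) (G : BipartiteGraph V C)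
    (i j : V) : ℝ :=
  ∫ l : V → ℝ, |gibbsCov (ldpcWeight G l) (fun x => spin (x i)) (fun x => spin (x j))|
    ∂(Measure.pi fun _ => W.llrLaw)

end SparseCode

end

/-! Duplicate the system: the covariance of `f` and `g` is half the average of `(f(x) - f(x')) (g(x)
- g(x'))` over two independent replicas. Exchanging the replicas on part of the graph changes the
sign of this product if exactly one of `i`, `j` is affected. Hence only configurations in which a
cluster of excited sites links `i` to `j` contribute. Such a cluster has more than `dist(i, j) / 2`
sites. On average each site costs a factor that tends to zero at the relevant end of the noise
interval. In graphs of bounded degree the number of clusters grows only exponentially with their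
size, so a Peierls-type sum gives exponential decay at any prescribed rate (`sum_largeClusters_le`).

LDGM, high noise: write `exp (l (x + x')) = exp (-2 |l|) (1 + K)` with `K ≥ 0` and expand the
product over check nodes. A set `S` of factors that does not connect `i` to `j` contributes zero
(`ldgm_vanish_of_not_connected`). Nonnegativity of `K` lets the remaining terms be resummed, and
each forced site costs `1 - exp (-4 |l|)` (`abs_sum_expansion_le`). At distance at most two the
sites `i`, `j` may use up the whole cluster. If `∂i ≠ ∂j`, flipping one information bit in both
replicas still yields a small factor (`ldgm_vanish_of_untouched`). If `∂i = ∂j` only the trivial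
bound is used, which is why `max ξ 1` appears.

LDPC, low noise: a site is excited if some replica differs from `1` there. The exchange is made on
the component of `i` in the excited set, which respects all parity checks (`sum_ldpcPhi_mul_eq`).
Erasing that component bounds its probability by a product of site weights (`sum_cluster_eq_le`),
whose mean is small by the low noise condition.

For each fixed rate the bound thus holds near the end of the interval; a diagonal choice
(`exists_monotone_rate`) turns this into one monotone, diverging rate `1 / ξ`. -/

namespace SparseCode

/-! ### Clusters in graphs of bounded degree -/

section Clusters

variable {S : Type}

open Classical in
/-- The vertex sets of the walks of length `n` that start at `v`. -/
noncomputable def walkSets [Fintype S] (H : SimpleGraph S) : ℕ → S → Finset (Finset S)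
  | 0, v => {{v}}
  | n + 1, v => (H.neighborFinset v).biUnion fun w => (walkSets H n w).image (insert v)

open Classical in
theorem card_walkSets_le [Fintype S] (H : SimpleGraph S) {Δ : ℕ}
    (hΔ : ∀ v, (H.neighborFinset v).card ≤ Δ) (n : ℕ) (v : S) :
    (walkSets H n v).card ≤ Δ ^ n := by
  induction n generalizing v with
  | zero => simp [walkSets]
  | succ n ih =>
    rw [walkSets]
    calc _ ≤ (H.neighborFinset v).card * Δ ^ n :=
          Finset.card_biUnion_le_card_mul _ _ _ fun w _ => Finset.card_image_le.trans (ih w)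
      _ ≤ Δ * Δ ^ n := Nat.mul_le_mul_right _ (hΔ v)
      _ = Δ ^ (n + 1) := by ring

open Classical in
theorem support_mem_walkSets [Fintype S] (H : SimpleGraph S) {v w : S} (p : H.Walk v w) :
    p.support.toFinset ∈ walkSets H p.length v := by
  induction p with
  | nil => simp [walkSets]
  | @cons u v w h p ih =>
    rw [SimpleGraph.Walk.length_cons, walkSets, Finset.mem_biUnion]
    refine ⟨v, by simpa using h, Finset.mem_image.2 ⟨_, ih, ?_⟩⟩
    simp

/-- A finite set of vertices that can be exhausted by starting at `i` and adding neighbours. -/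
def IsCluster (H : SimpleGraph S) (i : S) (A : Finset S) : Prop :=
  i ∈ A ∧ ∀ B ⊆ A, i ∈ B → B ≠ A → ∃ b ∈ B, ∃ a ∈ A, a ∉ B ∧ H.Adj b a

open Classical in
-- A closed walk around a growing spanning tree: each new vertex `a`, adjacent to a visited `b`, is
-- reached by inserting the detour `b, a, b`, which adds two steps. Hence clusters can be counted by
-- walks, and distances inside them are bounded by their size.
theorem IsCluster.exists_exhaustion {H : SimpleGraph S} {i : S} {A : Finset S}
    (hA : IsCluster H i A) (t : ℕ) (ht : t + 1 ≤ A.card) :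
    ∃ B ⊆ A, i ∈ B ∧ B.card = t + 1 ∧
      (∃ p : H.Walk i i, p.length = 2 * t ∧ p.support.toFinset = B) ∧
      ∀ b ∈ B, ∃ p : H.Walk i b, p.length ≤ t := by
  induction t with
  | zero =>
    refine ⟨{i}, by simpa using hA.1, by simp, by simp, ⟨.nil, by simp⟩, ?_⟩
    intro b hb
    obtain rfl : b = i := by simpa using hb
    exact ⟨.nil, by simp⟩
  | succ t ih =>
    obtain ⟨B, hBA, hiB, hcard, ⟨p, hpl, hps⟩, hw⟩ := ih (by omega)
    obtain ⟨b, hb, a, ha, haB, hab⟩ := hA.2 B hBA hiB (by rintro rfl; omega)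
    have hbp : b ∈ p.support := by rw [← List.mem_toFinset, hps]; exact hb
    refine ⟨insert a B, ?_, by simp [hiB], by rw [Finset.card_insert_of_notMem haB, hcard],
      ⟨(p.takeUntil b hbp).append (.cons hab (.cons hab.symm (p.dropUntil b hbp))), ?_, ?_⟩, ?_⟩
    · intro x hx
      rcases Finset.mem_insert.1 hx with rfl | hx
      · exact ha
      · exact hBA hx
    · have := congrArg SimpleGraph.Walk.length (p.take_spec hbp)
      simp only [SimpleGraph.Walk.length_append, SimpleGraph.Walk.length_cons] at this ⊢
      omega
    · ext x
      have h1 : x ∈ p.support ↔ x ∈ B := by rw [← hps, List.mem_toFinset]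
      rw [← p.take_spec hbp, SimpleGraph.Walk.mem_support_append_iff] at h1
      simp only [List.mem_toFinset, SimpleGraph.Walk.mem_support_append_iff,
        SimpleGraph.Walk.support_cons, List.mem_cons, Finset.mem_insert, ← h1]
      constructor
      · rintro (h | rfl | rfl | h)
        · tauto
        · exact Or.inr (Or.inr (SimpleGraph.Walk.start_mem_support _))
        · tauto
        · tauto
      · tauto
    · intro x hx
      rcases Finset.mem_insert.1 hx with rfl | hx
      · obtain ⟨q, hq⟩ := hw b hb
        exact ⟨q.concat hab, by simpa using hq⟩
      · obtain ⟨q, hq⟩ := hw x hx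
        exact ⟨q, by omega⟩

open Classical in
theorem IsCluster.mem_walkSets [Fintype S] {H : SimpleGraph S} {i : S} {A : Finset S}
    (hA : IsCluster H i A) : A ∈ walkSets H (2 * (A.card - 1)) i := by
  have hpos : 0 < A.card := Finset.card_pos.2 ⟨i, hA.1⟩
  obtain ⟨B, hBA, -, hc, ⟨p, hpl, hps⟩, -⟩ := hA.exists_exhaustion (A.card - 1) (by omega)
  obtain rfl : B = A := Finset.eq_of_subset_of_card_le hBA (by omega)
  have := support_mem_walkSets H p
  rwa [hps, hpl] at this

theorem IsCluster.exists_walk {H : SimpleGraph S} {i j : S} {A : Finset S}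
    (hA : IsCluster H i A) (hj : j ∈ A) : ∃ p : H.Walk i j, p.length ≤ A.card - 1 := by
  have hpos : 0 < A.card := Finset.card_pos.2 ⟨i, hA.1⟩
  obtain ⟨B, hBA, -, hc, -, hw⟩ := hA.exists_exhaustion (A.card - 1) (by omega)
  obtain rfl : B = A := Finset.eq_of_subset_of_card_le hBA (by omega)
  exact hw j hj

variable [Fintype S]

open Classical in
/-- The connected component of `i` in the subgraph induced on `D`. -/
noncomputable def clusterOf (H : SimpleGraph S) (D : Finset S) (i : S) : Finset S :=
  Finset.univ.filter fun k => Relation.ReflTransGen (fun a b => H.Adj a b ∧ b ∈ D) i k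

theorem mem_clusterOf_self (H : SimpleGraph S) (D : Finset S) (i : S) : i ∈ clusterOf H D i := by
  simp [clusterOf, Relation.ReflTransGen.refl]

theorem clusterOf_subset (H : SimpleGraph S) {D : Finset S} {i : S} (hi : i ∈ D) :
    clusterOf H D i ⊆ D := by
  intro k hk
  simp only [clusterOf, Finset.mem_filter, Finset.mem_univ, true_and] at hk
  cases hk with
  | refl => exact hi
  | tail _ h => exact h.2

theorem clusterOf_closed {H : SimpleGraph S} {D : Finset S} {i a b : S}
    (ha : a ∈ clusterOf H D i) (hb : b ∈ D) (hab : H.Adj a b) : b ∈ clusterOf H D i := by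
  simp only [clusterOf, Finset.mem_filter, Finset.mem_univ, true_and] at ha ⊢
  exact ha.tail ⟨hab, hb⟩

theorem isCluster_clusterOf (H : SimpleGraph S) (D : Finset S) (i : S) :
    IsCluster H i (clusterOf H D i) := by
  refine ⟨mem_clusterOf_self H D i, fun B hB hi hne => ?_⟩
  by_contra! hcon
  refine hne (Finset.Subset.antisymm hB fun k hk => ?_)
  simp only [clusterOf, Finset.mem_filter, Finset.mem_univ, true_and] at hk
  induction hk with
  | refl => exact hi
  | @tail b c hbc h ih =>
    by_contra hc
    refine hcon b ih c ?_ hc h.1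
    simp only [clusterOf, Finset.mem_filter, Finset.mem_univ, true_and]
    exact hbc.tail h

open Classical in
/-- The clusters at `i` of at least `d / 2 + 1` sites. -/
noncomputable def largeClusters (H : SimpleGraph S) (i : S) (d : ℕ) : Finset (Finset S) :=
  Finset.univ.filter fun A => IsCluster H i A ∧ d ≤ 2 * (A.card - 1)

open Classical in
-- Peierls sum. At most `Δ ^ (2 * t)` clusters at `i` have `t + 1` sites, one walk of length `2 * t`
-- each. Half of the smallness of `Δ² ρ` makes the series over `t` geometric, and the factor `exp
-- (-2 r)` supplies the decay because `2 * t ≥ d`.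
theorem sum_largeClusters_le (H : SimpleGraph S) {Δ : ℕ}
    (hΔ : ∀ v, (H.neighborFinset v).card ≤ Δ) (i : S) (d : ℕ) {ρ r : ℝ} (hρ : 0 ≤ ρ)
    (hr : 0 ≤ r) (h : (Δ : ℝ) ^ 2 * ρ ≤ 1 / 2 * Real.exp (-2 * r)) :
    ∑ A ∈ largeClusters H i d, ρ ^ (A.card - 1) ≤ 2 * Real.exp (-r * d) := by
  have hmaps : ∀ A ∈ largeClusters H i d,
      A.card - 1 ∈ Finset.range (Fintype.card S + 1) := fun A _ => by
    have := Finset.card_le_univ A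
    simp only [Finset.mem_range]; omega
  rw [← Finset.sum_fiberwise_of_maps_to hmaps]
  have key : ∀ t ∈ Finset.range (Fintype.card S + 1),
      ∑ A ∈ (largeClusters H i d).filter (fun A => A.card - 1 = t), ρ ^ (A.card - 1)
        ≤ Real.exp (-r * d) * (1 / 2 : ℝ) ^ t := by
    intro t _
    by_cases hd : d ≤ 2 * t
    · have hcard : ((largeClusters H i d).filter (fun A => A.card - 1 = t)).card ≤ Δ ^ (2 * t) := by
        refine (Finset.card_le_card ?_).trans (card_walkSets_le H hΔ (2 * t) i)
        intro A hA
        simp only [largeClusters, Finset.mem_filter, Finset.mem_univ, true_and] at hA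
        have := hA.1.1.mem_walkSets
        rwa [hA.2] at this
      calc _ = ∑ A ∈ (largeClusters H i d).filter (fun A => A.card - 1 = t), ρ ^ t :=
            Finset.sum_congr rfl fun A hA => by rw [(Finset.mem_filter.1 hA).2]
        _ = ((largeClusters H i d).filter (fun A => A.card - 1 = t)).card * ρ ^ t := by simp
        _ ≤ ((Δ ^ (2 * t) : ℕ) : ℝ) * ρ ^ t := by gcongr
        _ = ((Δ : ℝ) ^ 2 * ρ) ^ t := by push_cast; rw [mul_pow, pow_mul]
        _ ≤ (1 / 2 * Real.exp (-2 * r)) ^ t := by gcongr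
        _ = Real.exp (-r * (2 * t)) * (1 / 2 : ℝ) ^ t := by
            rw [mul_pow, ← Real.exp_nat_mul, mul_comm]; ring_nf
        _ ≤ _ := by
            have : (d : ℝ) ≤ 2 * t := by exact_mod_cast hd
            have : r * d ≤ r * (2 * t) := by gcongr
            gcongr ?_ * _
            exact Real.exp_le_exp.2 (by linarith)
    · rw [Finset.sum_eq_zero]
      · positivity
      · intro A hA
        simp only [largeClusters, Finset.mem_filter, Finset.mem_univ, true_and] at hA
        omega
  refine (Finset.sum_le_sum key).trans ?_
  rw [← Finset.mul_sum]
  have : ∑ t ∈ Finset.range (Fintype.card S + 1), (1 / 2 : ℝ) ^ t ≤ 2 :=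
    sum_geometric_two_le _
  nlinarith [Real.exp_pos (-r * d)]

end Clusters

/-! ### Sites that share a neighbour in a bipartite graph -/

section Share

variable {S T : Type}

/-- Two distinct sites are adjacent if they are related to a common element. -/
def shareGraph (R : S → T → Prop) : SimpleGraph S where
  Adj a b := a ≠ b ∧ ∃ c, R a c ∧ R b c
  symm := ⟨fun _ _ h => ⟨h.1.symm, h.2.imp fun _ hc => ⟨hc.2, hc.1⟩⟩⟩
  loopless := ⟨fun _ h => h.1 rfl⟩

/-- Each step between sites that share a neighbour is two edges of the bipartite graph, through that
neighbour. -/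
theorem edist_le_two_mul_length {X : Type} (G : SimpleGraph X) (R : S → T → Prop) (e : S → X)
    (f : T → X) (hef : ∀ a c, R a c → G.Adj (e a) (f c)) {a b : S}
    (p : (shareGraph R).Walk a b) : G.edist (e a) (e b) ≤ ((2 * p.length : ℕ) : ℕ∞) := by
  suffices ∃ q : G.Walk (e a) (e b), q.length = 2 * p.length by
    obtain ⟨q, hq⟩ := this
    rw [← hq]
    exact SimpleGraph.edist_le q
  induction p with
  | nil => exact ⟨.nil, rfl⟩
  | cons h p ih =>
    obtain ⟨q, hq⟩ := ih
    have hc := h.2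
    obtain ⟨c, h1, h2⟩ := hc
    refine ⟨.cons (hef _ _ h1) (.cons (hef _ _ h2).symm q), ?_⟩
    rw [SimpleGraph.Walk.length_cons, SimpleGraph.Walk.length_cons, SimpleGraph.Walk.length_cons]
    omega

open Classical in
theorem card_neighborFinset_shareGraph_le [Fintype S] [Fintype T] (R : S → T → Prop) {k l : ℕ}
    (hk : ∀ a, (Finset.univ.filter (fun c => R a c)).card ≤ k)
    (hl : ∀ c, (Finset.univ.filter (fun a => R a c)).card ≤ l) (a : S) :
    ((shareGraph R).neighborFinset a).card ≤ k * l := by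
  have hsub : (shareGraph R).neighborFinset a ⊆
      (Finset.univ.filter (fun c => R a c)).biUnion
        fun c => Finset.univ.filter (fun b => R b c) := by
    intro b hb
    rw [SimpleGraph.mem_neighborFinset] at hb
    obtain ⟨-, c, h1, h2⟩ := hb
    simp only [Finset.mem_biUnion, Finset.mem_filter, Finset.mem_univ, true_and]
    exact ⟨c, h1, h2⟩
  refine (Finset.card_le_card hsub).trans ?_
  exact (Finset.card_biUnion_le_card_mul _ _ _ fun c _ => hl c).trans
    (Nat.mul_le_mul_right _ (hk a))

end Share

/-! ### Two replicas -/

section Replicas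

variable {V : Type}

open Classical in
theorem sum_replicas [Fintype V] (F : (V → ℤˣ) → (V → ℤˣ) → ℝ) :
    ∑ ω : V → ℤˣ × ℤˣ, F (fun v => (ω v).1) (fun v => (ω v).2) = ∑ x, ∑ y, F x y := by
  rw [← Fintype.sum_prod_type']
  exact Fintype.sum_equiv (Equiv.arrowProdEquivProdArrow V (fun _ => ℤˣ) (fun _ => ℤˣ)) _ _
    fun ω => rfl

open Classical in
theorem gibbsCov_eq_replicas [Fintype V] (w f g : (V → ℤˣ) → ℝ) (hw : ∑ x, w x ≠ 0) :
    gibbsCov w f g =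
      (∑ ω : V → ℤˣ × ℤˣ, (f (fun v => (ω v).1) - f (fun v => (ω v).2)) *
        (g (fun v => (ω v).1) - g (fun v => (ω v).2)) *
          (w (fun v => (ω v).1) * w (fun v => (ω v).2))) /
      (2 * ∑ ω : V → ℤˣ × ℤˣ, w (fun v => (ω v).1) * w (fun v => (ω v).2)) := by
  rw [sum_replicas (fun x y => (f x - f y) * (g x - g y) * (w x * w y)),
    sum_replicas (fun x y => w x * w y), ← Finset.sum_mul_sum]
  have h : ∑ x, ∑ y, (f x - f y) * (g x - g y) * (w x * w y) =
      2 * ((∑ x, f x * g x * w x) * (∑ x, w x) - (∑ x, f x * w x) * (∑ x, g x * w x)) := by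
    have h1 := Finset.sum_mul_sum Finset.univ Finset.univ (fun x => f x * g x * w x) w
    have h2 := Finset.sum_mul_sum Finset.univ Finset.univ w (fun x => f x * g x * w x)
    have h3 := Finset.sum_mul_sum Finset.univ Finset.univ (fun x => f x * w x) (fun x => g x * w x)
    have h4 := Finset.sum_mul_sum Finset.univ Finset.univ (fun x => g x * w x) (fun x => f x * w x)
    have : ∑ x, ∑ y, (f x - f y) * (g x - g y) * (w x * w y) =
        (∑ x, f x * g x * w x) * (∑ x, w x) + (∑ x, w x) * (∑ x, f x * g x * w x)
        - (∑ x, f x * w x) * (∑ x, g x * w x) - (∑ x, g x * w x) * (∑ x, f x * w x) := by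
      rw [h1, h2, h3, h4]
      simp only [← Finset.sum_add_distrib, ← Finset.sum_sub_distrib]
      exact Finset.sum_congr rfl fun x _ => Finset.sum_congr rfl fun y _ => by ring
    rw [this]; ring
  rw [h]
  unfold gibbsCov gibbs
  field_simp

theorem abs_spin (x : ℤˣ) : |spin x| = 1 := by
  rcases Int.units_eq_one_or x with rfl | rfl <;> simp [spin]

theorem spin_one : spin 1 = 1 := by simp [spin]

theorem spin_neg (x : ℤˣ) : spin (-x) = -spin x := by simp [spin]

theorem abs_spin_sub_mul_le (a b c d : ℤˣ) :
    |(spin a - spin b) * (spin c - spin d)| ≤ 4 := by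
  have h (x y : ℤˣ) : |spin x - spin y| ≤ 2 := by
    have := abs_sub (spin x) (spin y)
    rw [abs_spin, abs_spin] at this
    linarith
  rw [abs_mul]
  nlinarith [h a b, h c d, abs_nonneg (spin a - spin b), abs_nonneg (spin c - spin d)]

open Classical in
theorem sum_eq_zero_of_odd {Ω : Type} [Fintype Ω] (τ : Ω → Ω) (hτ : Function.Involutive τ)
    (F : Ω → ℝ) (h : ∀ ω, F (τ ω) = -F ω) : ∑ ω, F ω = 0 := by
  have h1 : ∑ ω, F (τ ω) = ∑ ω, F ω := Fintype.sum_equiv hτ.toPerm _ _ fun _ => rfl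
  simp only [h, Finset.sum_neg_distrib] at h1
  linarith

open Classical in
/-- Exchange of the two replicas on the set `U`. -/
noncomputable def swapOn (U : Finset V) (ω : V → ℤˣ × ℤˣ) : V → ℤˣ × ℤˣ :=
  fun v => if v ∈ U then (ω v).swap else ω v

theorem swapOn_involutive (U : Finset V) : Function.Involutive (swapOn U) := by
  intro ω
  funext v
  by_cases h : v ∈ U <;> simp [swapOn, h]

theorem swapOn_of_mem {U : Finset V} {v : V} (h : v ∈ U) (ω : V → ℤˣ × ℤˣ) :
    swapOn U ω v = (ω v).swap := by simp [swapOn, h]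

theorem swapOn_of_notMem {U : Finset V} {v : V} (h : v ∉ U) (ω : V → ℤˣ × ℤˣ) :
    swapOn U ω v = ω v := by simp [swapOn, h]

end Replicas

/-! ### The high-temperature expansion -/

section Expansion

variable {Ω C ι : Type} [Fintype Ω] [Fintype C]

open Classical in
-- The sum over supersets factorizes: sites of `Γ` must contribute `K`, the others contribute `1 +
-- K`. The hypothesis `hp` bounds each forced `K` by `p` times the full factor.
theorem sum_supersets_prod_le (Γ : Finset C) (K p : C → ℝ) (hK : ∀ k, 0 ≤ K k)
    (hp : ∀ k, K k ≤ p k * (1 + K k)) :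
    ∑ S : Finset C, (if Γ ⊆ S then ∏ k ∈ S, K k else 0) ≤
      (∏ k ∈ Γ, p k) * ∏ k, (1 + K k) := by
  have h1 : ∑ S : Finset C, (if Γ ⊆ S then ∏ k ∈ S, K k else 0) =
      ∏ k, (K k + if k ∈ Γ then 0 else 1) := by
    rw [Finset.prod_add, Finset.powerset_univ]
    refine Finset.sum_congr rfl fun S _ => ?_
    by_cases h : Γ ⊆ S
    · have : ∏ k ∈ Finset.univ \ S, (if k ∈ Γ then (0 : ℝ) else 1) = 1 :=
        Finset.prod_eq_one fun k hk => if_neg fun hk' => (Finset.mem_sdiff.1 hk).2 (h hk')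
      rw [if_pos h, this, mul_one]
    · obtain ⟨k, hk, hkS⟩ := Finset.not_subset.1 h
      have : ∏ k ∈ Finset.univ \ S, (if k ∈ Γ then (0 : ℝ) else 1) = 0 :=
        Finset.prod_eq_zero (i := k) (by simpa using hkS) (by simp [hk])
      rw [if_neg h, this, mul_zero]
  have h2 : (∏ k ∈ Γ, p k) = ∏ k, (if k ∈ Γ then p k else 1) := by
    rw [Finset.prod_ite_mem, Finset.univ_inter]
  rw [h1, h2, ← Finset.prod_mul_distrib]
  refine Finset.prod_le_prod (fun k _ => ?_) fun k _ => ?_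
  · have := hK k
    split_ifs <;> linarith
  · split_ifs
    · simpa using hp k
    · linarith

open Classical in
-- Every set `S` with a nonzero contribution contains some `Γ t`. Since all terms `∏ K` are
-- nonnegative, a union bound over `t` may overcount, and the supersets of each `Γ t` resum to the
-- partition function.
theorem abs_sum_expansion_le (Φ : Ω → ℝ) (K : C → Ω → ℝ) (p : C → ℝ) {M : ℝ}
    (hK : ∀ k ω, 0 ≤ K k ω) (hp : ∀ k ω, K k ω ≤ p k * (1 + K k ω)) (hΦ : ∀ ω, |Φ ω| ≤ M)
    (hM : 0 ≤ M) (𝒢 : Finset ι) (Γ : ι → Finset C)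
    (hvanish : ∀ S : Finset C, (∀ t ∈ 𝒢, ¬ Γ t ⊆ S) → ∑ ω, Φ ω * ∏ k ∈ S, K k ω = 0) :
    |∑ ω, Φ ω * ∏ k, (1 + K k ω)| ≤
      M * (∑ t ∈ 𝒢, ∏ k ∈ Γ t, p k) * ∑ ω, ∏ k, (1 + K k ω) := by
  have hS : ∀ S : Finset C, |∑ ω, Φ ω * ∏ k ∈ S, K k ω| ≤
      ∑ t ∈ 𝒢, M * ∑ ω, (if Γ t ⊆ S then ∏ k ∈ S, K k ω else 0) := by
    intro S
    have hnn : ∀ t, 0 ≤ M * ∑ ω, (if Γ t ⊆ S then ∏ k ∈ S, K k ω else 0) := fun t => by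
      refine mul_nonneg hM (Finset.sum_nonneg fun ω _ => ?_)
      split_ifs
      · exact Finset.prod_nonneg fun k _ => hK k ω
      · exact le_rfl
    by_cases h : ∀ t ∈ 𝒢, ¬ Γ t ⊆ S
    · rw [hvanish S h, abs_zero]
      exact Finset.sum_nonneg fun t _ => hnn t
    · push Not at h
      obtain ⟨t, ht, hts⟩ := h
      refine le_trans ?_ (Finset.single_le_sum (fun t _ => hnn t) ht)
      rw [Finset.mul_sum]
      refine (Finset.abs_sum_le_sum_abs _ _).trans (Finset.sum_le_sum fun ω _ => ?_)
      rw [if_pos hts, abs_mul, abs_of_nonneg (Finset.prod_nonneg fun k _ => hK k ω)]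
      exact mul_le_mul_of_nonneg_right (hΦ ω) (Finset.prod_nonneg fun k _ => hK k ω)
  calc |∑ ω, Φ ω * ∏ k, (1 + K k ω)|
      = |∑ S : Finset C, ∑ ω, Φ ω * ∏ k ∈ S, K k ω| := by
        rw [Finset.sum_comm]
        congr 1
        refine Finset.sum_congr rfl fun ω _ => ?_
        rw [Finset.prod_one_add, Finset.mul_sum, Finset.powerset_univ]
    _ ≤ ∑ S : Finset C, ∑ t ∈ 𝒢, M * ∑ ω, (if Γ t ⊆ S then ∏ k ∈ S, K k ω else 0) :=
        (Finset.abs_sum_le_sum_abs _ _).trans (Finset.sum_le_sum fun S _ => hS S)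
    _ = M * ∑ t ∈ 𝒢, ∑ ω, ∑ S : Finset C, (if Γ t ⊆ S then ∏ k ∈ S, K k ω else 0) := by
        rw [Finset.sum_comm, Finset.mul_sum]
        refine Finset.sum_congr rfl fun t _ => ?_
        rw [← Finset.mul_sum, Finset.sum_comm]
    _ ≤ M * ∑ t ∈ 𝒢, ∑ ω, (∏ k ∈ Γ t, p k) * ∏ k, (1 + K k ω) := by
        gcongr with t _ ω _
        exact sum_supersets_prod_le (Γ t) (fun k => K k ω) p (fun k => hK k ω) fun k => hp k ω
    _ = _ := by
        simp_rw [← Finset.mul_sum]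
        rw [← Finset.sum_mul, mul_assoc]

end Expansion

/-! ### Covariances of LDGM codes -/

section LDGM

variable {V C : Type} [Fintype V]

/-- The interaction `K` in `exp (l (x + x')) = exp (-2 |l|) (1 + K)`. -/
noncomputable def mayerWeight (l s : ℝ) : ℝ := Real.exp (2 * |l| + l * s) - 1

theorem mayerWeight_nonneg (l : ℝ) (a b : ℤˣ) : 0 ≤ mayerWeight l (spin a + spin b) := by
  have h : |l * (spin a + spin b)| ≤ 2 * |l| := by
    rw [abs_mul, mul_comm]
    have := abs_add_le (spin a) (spin b)
    rw [abs_spin, abs_spin] at this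
    gcongr
    linarith
  have := neg_abs_le (l * (spin a + spin b))
  have := Real.one_le_exp (x := 2 * |l| + l * (spin a + spin b)) (by linarith)
  unfold mayerWeight
  linarith

theorem mayerWeight_le (l : ℝ) (a b : ℤˣ) : mayerWeight l (spin a + spin b) ≤
    (1 - Real.exp (-4 * |l|)) * (1 + mayerWeight l (spin a + spin b)) := by
  have h : |l * (spin a + spin b)| ≤ 2 * |l| := by
    rw [abs_mul, mul_comm]
    have := abs_add_le (spin a) (spin b)
    rw [abs_spin, abs_spin] at this
    gcongr
    linarith
  have h2 := le_abs_self (l * (spin a + spin b))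
  have : Real.exp (-4 * |l|) * Real.exp (2 * |l| + l * (spin a + spin b)) ≤ 1 := by
    rw [← Real.exp_add]
    exact Real.exp_le_one_iff.2 (by linarith)
  unfold mayerWeight
  linarith

/-- The product `(x_i - x_i') (x_j - x_j')` in two replicas of an LDGM code. -/
noncomputable def ldgmPhi (G : BipartiteGraph V C) (i j : C) (ω : V → ℤˣ × ℤˣ) : ℝ :=
  (spin (ldgmBit G (fun v => (ω v).1) i) - spin (ldgmBit G (fun v => (ω v).2) i)) *
    (spin (ldgmBit G (fun v => (ω v).1) j) - spin (ldgmBit G (fun v => (ω v).2) j))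

/-- The interaction of the two replicas at the check node `k`. -/
noncomputable def ldgmMayer (G : BipartiteGraph V C) (l : C → ℝ) (k : C) (ω : V → ℤˣ × ℤˣ) : ℝ :=
  mayerWeight (l k)
    (spin (ldgmBit G (fun v => (ω v).1) k) + spin (ldgmBit G (fun v => (ω v).2) k))

open Classical in
theorem abs_gibbsCov_ldgm_le [Fintype C] {ι : Type} (G : BipartiteGraph V C) (l : C → ℝ) (i j : C)
    (𝒢 : Finset ι) (Γ : ι → Finset C)
    (hvanish : ∀ S : Finset C, (∀ t ∈ 𝒢, ¬ Γ t ⊆ S) →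
      ∑ ω, ldgmPhi G i j ω * ∏ k ∈ S, ldgmMayer G l k ω = 0) :
    |gibbsCov (ldgmWeight G l) (fun u => spin (ldgmBit G u i)) (fun u => spin (ldgmBit G u j))| ≤
      2 * ∑ t ∈ 𝒢, ∏ k ∈ Γ t, (1 - Real.exp (-4 * |l k|)) := by
  have hpos : ∀ u, 0 < ldgmWeight G l u := fun u => Finset.prod_pos fun _ _ => Real.exp_pos _
  have hW : ∀ ω : V → ℤˣ × ℤˣ, ldgmWeight G l (fun v => (ω v).1) * ldgmWeight G l (fun v => (ω v).2)
      = (∏ k, Real.exp (-2 * |l k|)) * ∏ k, (1 + ldgmMayer G l k ω) := by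
    intro ω
    unfold ldgmWeight
    rw [← Finset.prod_mul_distrib, ← Finset.prod_mul_distrib]
    refine Finset.prod_congr rfl fun k _ => ?_
    unfold ldgmMayer mayerWeight
    rw [add_sub_cancel, ← Real.exp_add, ← Real.exp_add]
    ring_nf
  have hc : 0 < ∏ k, Real.exp (-2 * |l k|) := Finset.prod_pos fun _ _ => Real.exp_pos _
  have hZ : 0 < ∑ ω : V → ℤˣ × ℤˣ, ∏ k, (1 + ldgmMayer G l k ω) := by
    refine Finset.sum_pos (fun ω _ => Finset.prod_pos fun k _ => ?_) Finset.univ_nonempty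
    have := mayerWeight_nonneg (l k) (ldgmBit G (fun v => (ω v).1) k)
      (ldgmBit G (fun v => (ω v).2) k)
    unfold ldgmMayer
    linarith
  rw [gibbsCov_eq_replicas _ _ _ (Finset.sum_pos (fun u _ => hpos u) Finset.univ_nonempty).ne']
  simp only [hW, ← Finset.mul_sum]
  have hnum : ∑ ω : V → ℤˣ × ℤˣ, (spin (ldgmBit G (fun v => (ω v).1) i) -
      spin (ldgmBit G (fun v => (ω v).2) i)) * (spin (ldgmBit G (fun v => (ω v).1) j) -
        spin (ldgmBit G (fun v => (ω v).2) j)) *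
      ((∏ k, Real.exp (-2 * |l k|)) * ∏ k, (1 + ldgmMayer G l k ω)) =
      (∏ k, Real.exp (-2 * |l k|)) * ∑ ω, ldgmPhi G i j ω * ∏ k, (1 + ldgmMayer G l k ω) := by
    rw [Finset.mul_sum]
    exact Finset.sum_congr rfl fun ω _ => by unfold ldgmPhi; ring
  -- The common factor `∏ exp (-2 |l k|)` cancels. The bound `4` on the product of spin differences
  -- over the `2` of the replica formula leaves the constant `2`.
  rw [hnum, mul_left_comm, mul_div_mul_left _ _ hc.ne', abs_div,
    abs_of_pos (show (0 : ℝ) < 2 * _ by positivity), div_le_iff₀ (by positivity)]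
  refine (abs_sum_expansion_le (ldgmPhi G i j) (ldgmMayer G l) (fun k => 1 - Real.exp (-4 * |l k|))
    (fun k ω => mayerWeight_nonneg _ _ _) (fun k ω => mayerWeight_le _ _ _)
    (fun ω => abs_spin_sub_mul_le _ _ _ _) (by norm_num) 𝒢 Γ hvanish).trans (le_of_eq ?_)
  ring

/-- The graph on the check nodes in which nodes with a common variable node are adjacent. -/
def BipartiteGraph.checkGraph (G : BipartiteGraph V C) : SimpleGraph C :=
  shareGraph fun c v => G.Adj v c

open Classical in
-- Exchange the replicas on all information bits that touch the component of `i`. Checks of `D`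
-- outside the component share no information bit with it, so their code-bits, including `x_j`, are
-- unaffected. The interactions are symmetric under exchange, and only the factor of `i` changes
-- sign.
theorem ldgm_vanish_of_not_connected [Fintype C] (G : BipartiteGraph V C) (l : C → ℝ) (i j : C)
    (S : Finset C) (hj : j ∉ clusterOf G.checkGraph (insert i (insert j S)) i) :
    ∑ ω, ldgmPhi G i j ω * ∏ k ∈ S, ldgmMayer G l k ω = 0 := by
  set D := insert i (insert j S) with hD
  set A := clusterOf G.checkGraph D i with hA
  set U : Finset V := A.biUnion fun k => G.checkNbhd k with hU
  have hin : ∀ k ∈ A, ∀ ω, ldgmBit G (fun v => (swapOn U ω v).1) k = ldgmBit G (fun v => (ω v).2) k ∧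
      ldgmBit G (fun v => (swapOn U ω v).2) k = ldgmBit G (fun v => (ω v).1) k := by
    intro k hk ω
    have hv : ∀ v ∈ G.checkNbhd k, swapOn U ω v = (ω v).swap := fun v hv =>
      swapOn_of_mem (Finset.mem_biUnion.2 ⟨k, hk, hv⟩) ω
    constructor <;> exact Finset.prod_congr rfl fun v hv' => by simp [hv v hv']
  have hout : ∀ k ∈ D, k ∉ A → ∀ ω,
      ldgmBit G (fun v => (swapOn U ω v).1) k = ldgmBit G (fun v => (ω v).1) k ∧
      ldgmBit G (fun v => (swapOn U ω v).2) k = ldgmBit G (fun v => (ω v).2) k := by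
    intro k hkD hk ω
    have hv : ∀ v ∈ G.checkNbhd k, swapOn U ω v = ω v := by
      intro v hv
      refine swapOn_of_notMem (fun hvU => hk ?_) ω
      obtain ⟨a, ha, hva⟩ := Finset.mem_biUnion.1 hvU
      refine clusterOf_closed ha hkD ⟨by rintro rfl; exact hk ha, v, ?_, ?_⟩
      · simpa [BipartiteGraph.checkNbhd] using hva
      · simpa [BipartiteGraph.checkNbhd] using hv
    constructor <;> exact Finset.prod_congr rfl fun v hv' => by simp [hv v hv']
  refine sum_eq_zero_of_odd (swapOn U) (swapOn_involutive U) _ fun ω => ?_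
  have h1 : ldgmPhi G i j (swapOn U ω) = -ldgmPhi G i j ω := by
    have hi := hin i (mem_clusterOf_self _ _ _) ω
    have hj' := hout j (by simp [hD]) hj ω
    unfold ldgmPhi
    rw [hi.1, hi.2, hj'.1, hj'.2]
    ring
  have h2 : ∀ k ∈ S, ldgmMayer G l k (swapOn U ω) = ldgmMayer G l k ω := by
    intro k hk
    unfold ldgmMayer
    by_cases hkA : k ∈ A
    · rw [(hin k hkA ω).1, (hin k hkA ω).2, add_comm]
    · have := hout k (by simp [hD, hk]) hkA ω
      rw [this.1, this.2]
  rw [h1, Finset.prod_congr rfl h2, neg_mul]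

open Classical in
-- Flipping the bit `a` in both replicas changes the sign of exactly one of the two differences and
-- leaves every interaction in `S` alone.
theorem ldgm_vanish_of_untouched (G : BipartiteGraph V C) (l : C → ℝ) (i j : C)
    (S : Finset C) (a : V) (ha : ¬ (a ∈ G.checkNbhd i ↔ a ∈ G.checkNbhd j))
    (hS : ∀ k ∈ S, a ∉ G.checkNbhd k) :
    ∑ ω, ldgmPhi G i j ω * ∏ k ∈ S, ldgmMayer G l k ω = 0 := by
  let τ : (V → ℤˣ × ℤˣ) → (V → ℤˣ × ℤˣ) := fun ω => Function.update ω a (-ω a)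
  have hτ : Function.Involutive τ := fun ω => by simp [τ]
  have hne : ∀ k, a ∉ G.checkNbhd k → ∀ ω,
      ldgmBit G (fun v => (τ ω v).1) k = ldgmBit G (fun v => (ω v).1) k ∧
      ldgmBit G (fun v => (τ ω v).2) k = ldgmBit G (fun v => (ω v).2) k := by
    intro k hk ω
    have hv : ∀ v ∈ G.checkNbhd k, τ ω v = ω v := fun v hv =>
      Function.update_of_ne (by rintro rfl; exact hk hv) _ _
    constructor <;> exact Finset.prod_congr rfl fun v hv' => by simp [hv v hv']
  have hmem : ∀ k, a ∈ G.checkNbhd k → ∀ ω,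
      ldgmBit G (fun v => (τ ω v).1) k = -ldgmBit G (fun v => (ω v).1) k ∧
      ldgmBit G (fun v => (τ ω v).2) k = -ldgmBit G (fun v => (ω v).2) k := by
    intro k hk ω
    have hv : ∀ v ∈ (G.checkNbhd k).erase a, τ ω v = ω v := fun v hv =>
      Function.update_of_ne (Finset.ne_of_mem_erase hv) _ _
    have ha' : τ ω a = -ω a := Function.update_self _ _ _
    unfold ldgmBit
    constructor <;>
    · rw [← Finset.mul_prod_erase _ _ hk, ← Finset.mul_prod_erase _ _ hk, ← neg_mul, ha']
      congr 1
      exact Finset.prod_congr rfl fun v hv' => by simp [hv v hv']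
  refine sum_eq_zero_of_odd τ hτ _ fun ω => ?_
  have h1 : ldgmPhi G i j (τ ω) = -ldgmPhi G i j ω := by
    unfold ldgmPhi
    by_cases hi : a ∈ G.checkNbhd i
    · have hj : a ∉ G.checkNbhd j := fun hj => ha (by simp [hi, hj])
      rw [(hmem i hi ω).1, (hmem i hi ω).2, (hne j hj ω).1, (hne j hj ω).2, spin_neg, spin_neg]
      ring
    · have hj : a ∈ G.checkNbhd j := by
        by_contra hj; exact ha (by simp [hi, hj])
      rw [(hmem j hj ω).1, (hmem j hj ω).2, (hne i hi ω).1, (hne i hi ω).2, spin_neg, spin_neg]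
      ring
  have h2 : ∀ k ∈ S, ldgmMayer G l k (τ ω) = ldgmMayer G l k ω := fun k hk => by
    unfold ldgmMayer
    rw [(hne k (hS k hk) ω).1, (hne k (hS k hk) ω).2]
  rw [h1, Finset.prod_congr rfl h2, neg_mul]

end LDGM

/-! ### Covariances of LDPC codes -/

section LDPC

variable {V C : Type}

theorem abs_prod_spin (s : Finset V) (x : V → ℤˣ) : |∏ v ∈ s, spin (x v)| = 1 := by
  rw [Finset.abs_prod]
  exact Finset.prod_eq_one fun v _ => abs_spin _

variable [Fintype V]

/-- The parity constraint at the check node `c`. -/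
noncomputable def parityFactor (G : BipartiteGraph V C) (c : C) (x : V → ℤˣ) : ℝ :=
  1 / 2 * (1 + ∏ v ∈ G.checkNbhd c, spin (x v))

theorem parityFactor_congr (G : BipartiteGraph V C) {c : C} {x y : V → ℤˣ}
    (h : ∀ v ∈ G.checkNbhd c, x v = y v) : parityFactor G c x = parityFactor G c y := by
  unfold parityFactor
  rw [Finset.prod_congr rfl fun v hv => by rw [h v hv]]

theorem parityFactor_nonneg (G : BipartiteGraph V C) (c : C) (x : V → ℤˣ) :
    0 ≤ parityFactor G c x := by
  have := neg_abs_le (∏ v ∈ G.checkNbhd c, spin (x v))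
  rw [abs_prod_spin] at this
  unfold parityFactor
  linarith

theorem parityFactor_le_one (G : BipartiteGraph V C) (c : C) (x : V → ℤˣ) :
    parityFactor G c x ≤ 1 := by
  have := le_abs_self (∏ v ∈ G.checkNbhd c, spin (x v))
  rw [abs_prod_spin] at this
  unfold parityFactor
  linarith

theorem parityFactor_one (G : BipartiteGraph V C) (c : C) :
    parityFactor G c (fun _ => 1) = 1 := by
  simp [parityFactor, spin_one]
  norm_num

/-- The graph on the variable nodes in which nodes with a common check node are adjacent. -/
def BipartiteGraph.varGraph (G : BipartiteGraph V C) : SimpleGraph V :=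
  shareGraph fun v c => G.Adj v c

/-- The sites where at least one of two replicas differs from the all-one configuration. -/
def replicaSupport (ω : V → ℤˣ × ℤˣ) : Finset V := Finset.univ.filter fun v => ω v ≠ 1

theorem mem_replicaSupport {ω : V → ℤˣ × ℤˣ} {v : V} : v ∈ replicaSupport ω ↔ ω v ≠ 1 := by
  simp [replicaSupport]

/-- The connected component of `i` in the support of two replicas. -/
noncomputable def replicaCluster (G : BipartiteGraph V C) (i : V) (ω : V → ℤˣ × ℤˣ) : Finset V :=
  clusterOf G.varGraph (replicaSupport ω) i

/-- The neighbours of a check are pairwise adjacent in `varGraph`, so a check that meets the cluster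
has all its excited neighbours in it. Operations on the cluster therefore act on whole parity
constraints. -/
theorem check_dichotomy (G : BipartiteGraph V C) (i : V) (ω : V → ℤˣ × ℤˣ) (c : C) :
    (∀ v ∈ G.checkNbhd c, v ∉ replicaCluster G i ω) ∨
      ∀ v ∈ G.checkNbhd c, v ∉ replicaCluster G i ω → ω v = 1 := by
  by_contra! hcon
  obtain ⟨⟨a, hac, ha⟩, v, hvc, hv, hv1⟩ := hcon
  refine hv (clusterOf_closed ha (mem_replicaSupport.2 hv1)
    ⟨by rintro rfl; exact hv ha, c, ?_, ?_⟩)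
  · simpa [BipartiteGraph.checkNbhd] using hac
  · simpa [BipartiteGraph.checkNbhd] using hvc

theorem replicaSupport_swapOn (U : Finset V) (ω : V → ℤˣ × ℤˣ) :
    replicaSupport (swapOn U ω) = replicaSupport ω := by
  ext v
  rw [mem_replicaSupport, mem_replicaSupport]
  by_cases h : v ∈ U
  · rw [swapOn_of_mem h, not_iff_not]
    exact ⟨fun h => by simpa using congrArg Prod.swap h, fun h => by rw [h]; rfl⟩
  · rw [swapOn_of_notMem h]

variable [Fintype C]

/-- The weight of two replicas of an LDPC code. -/
noncomputable def ldpcPairWeight (G : BipartiteGraph V C) (l : V → ℝ) (ω : V → ℤˣ × ℤˣ) : ℝ :=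
  ldpcWeight G l (fun v => (ω v).1) * ldpcWeight G l (fun v => (ω v).2)

theorem ldpcPairWeight_eq (G : BipartiteGraph V C) (l : V → ℝ) (ω : V → ℤˣ × ℤˣ) :
    ldpcPairWeight G l ω =
      (∏ c, parityFactor G c (fun v => (ω v).1) * parityFactor G c (fun v => (ω v).2)) *
        ∏ v, Real.exp (l v * (spin (ω v).1 + spin (ω v).2)) := by
  simp_rw [mul_add (l _), Real.exp_add]
  rw [Finset.prod_mul_distrib, Finset.prod_mul_distrib, mul_mul_mul_comm]
  rfl

theorem ldpcPairWeight_nonneg (G : BipartiteGraph V C) (l : V → ℝ) (ω : V → ℤˣ × ℤˣ) :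
    0 ≤ ldpcPairWeight G l ω := by
  rw [ldpcPairWeight_eq]
  exact mul_nonneg (Finset.prod_nonneg fun c _ =>
    mul_nonneg (parityFactor_nonneg _ _ _) (parityFactor_nonneg _ _ _))
    (Finset.prod_nonneg fun v _ => (Real.exp_pos _).le)

open Classical in
theorem sum_ldpcWeight_pos (G : BipartiteGraph V C) (l : V → ℝ) : 0 < ∑ x, ldpcWeight G l x := by
  refine Finset.sum_pos' (fun x _ => ?_) ⟨fun _ => 1, Finset.mem_univ _, ?_⟩
  · exact mul_nonneg (Finset.prod_nonneg fun c _ => parityFactor_nonneg G c x)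
      (Finset.prod_nonneg fun v _ => (Real.exp_pos _).le)
  · exact mul_pos (Finset.prod_pos fun c _ => by
      have := parityFactor_one G c
      unfold parityFactor at this
      rw [this]; exact one_pos) (Finset.prod_pos fun v _ => Real.exp_pos _)

theorem ldpcPairWeight_swapOn (G : BipartiteGraph V C) (l : V → ℝ) (i : V) (ω : V → ℤˣ × ℤˣ) :
    ldpcPairWeight G l (swapOn (replicaCluster G i ω) ω) = ldpcPairWeight G l ω := by
  rw [ldpcPairWeight_eq, ldpcPairWeight_eq]
  congr 1
  · refine Finset.prod_congr rfl fun c _ => ?_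
    rcases check_dichotomy G i ω c with h | h
    · rw [parityFactor_congr G (y := fun v => (ω v).1) fun v hv => by
        rw [swapOn_of_notMem (h v hv)], parityFactor_congr G (x := fun v => (swapOn _ ω v).2)
          (y := fun v => (ω v).2) fun v hv => by rw [swapOn_of_notMem (h v hv)]]
    · have hs : ∀ v ∈ G.checkNbhd c, swapOn (replicaCluster G i ω) ω v = (ω v).swap := by
        intro v hv
        by_cases hvA : v ∈ replicaCluster G i ω
        · exact swapOn_of_mem hvA ω
        · rw [swapOn_of_notMem hvA, h v hv hvA]; rfl
      rw [parityFactor_congr G (y := fun v => (ω v).2) fun v hv => by rw [hs v hv]; rfl,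
        parityFactor_congr G (x := fun v => (swapOn _ ω v).2) (y := fun v => (ω v).1)
          fun v hv => by rw [hs v hv]; rfl, mul_comm]
  · refine Finset.prod_congr rfl fun v _ => ?_
    by_cases h : v ∈ replicaCluster G i ω
    · rw [swapOn_of_mem h, Prod.fst_swap, Prod.snd_swap, add_comm]
    · rw [swapOn_of_notMem h]

/-- The product `(x_i - x_i') (x_j - x_j')` in two replicas of an LDPC code. -/
def ldpcPhi (i j : V) (ω : V → ℤˣ × ℤˣ) : ℝ :=
  (spin (ω i).1 - spin (ω i).2) * (spin (ω j).1 - spin (ω j).2)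

open Classical in
theorem sum_ldpcPhi_mul_eq (G : BipartiteGraph V C) (l : V → ℝ) (i j : V) :
    ∑ ω, ldpcPhi i j ω * ldpcPairWeight G l ω =
      ∑ ω, if i ∈ replicaSupport ω ∧ j ∈ replicaCluster G i ω then
        ldpcPhi i j ω * ldpcPairWeight G l ω else 0 := by
  -- The exchanged set depends on `ω`; the map is still an involution because exchange preserves the
  -- support, hence the cluster.
  let τ : (V → ℤˣ × ℤˣ) → (V → ℤˣ × ℤˣ) := fun ω => swapOn (replicaCluster G i ω) ω
  have hsupp : ∀ ω, replicaSupport (τ ω) = replicaSupport ω := fun ω => replicaSupport_swapOn _ ω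
  have hcl : ∀ ω, replicaCluster G i (τ ω) = replicaCluster G i ω := fun ω => by
    unfold replicaCluster
    rw [hsupp]
  have hτ : Function.Involutive τ := fun ω => by
    change swapOn (replicaCluster G i (τ ω)) (τ ω) = ω
    rw [hcl]
    exact swapOn_involutive _ ω
  rw [← sub_eq_zero, ← Finset.sum_sub_distrib]
  refine sum_eq_zero_of_odd τ hτ _ fun ω => ?_
  have hout : ∀ ω : V → ℤˣ × ℤˣ, i ∉ replicaSupport ω → ldpcPhi i j ω = 0 := fun ω hi => by
    rw [mem_replicaSupport, not_not] at hi
    simp [ldpcPhi, hi]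
  rw [hsupp, hcl]
  by_cases hi : i ∈ replicaSupport ω
  · by_cases hj : j ∈ replicaCluster G i ω
    · simp [hi, hj]
    · have h1 : ldpcPhi i j (τ ω) = -ldpcPhi i j ω := by
        have hii : τ ω i = (ω i).swap := swapOn_of_mem (mem_clusterOf_self _ _ _) ω
        have hjj : τ ω j = ω j := swapOn_of_notMem hj ω
        unfold ldpcPhi
        rw [hii, hjj, Prod.fst_swap, Prod.snd_swap]
        ring
      have h2 : ldpcPairWeight G l (τ ω) = ldpcPairWeight G l ω := ldpcPairWeight_swapOn G l i ω
      simp [hj, h1, h2]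
  · rw [hout ω hi, hout (τ ω) (by rwa [hsupp])]
    simp

open Classical in
/-- The restriction of two replicas to `A`, extended by the all-one configuration. -/
noncomputable def restrictReplicas (A : Finset V) (ω : V → ℤˣ × ℤˣ) : V → ℤˣ × ℤˣ :=
  fun v => if v ∈ A then ω v else 1

open Classical in
/-- Two replicas with the configuration on `A` replaced by the all-one configuration. -/
noncomputable def eraseReplicas (A : Finset V) (ω : V → ℤˣ × ℤˣ) : V → ℤˣ × ℤˣ :=
  fun v => if v ∈ A then 1 else ω v

open Classical in
-- After erasure a check that meets the cluster sees only ones, so its parity factor rises to `1`;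
-- the other checks see no change.
theorem ldpcPairWeight_le_erase (G : BipartiteGraph V C) (l : V → ℝ) (i : V)
    (ω : V → ℤˣ × ℤˣ) (A : Finset V) (hA : replicaCluster G i ω = A) :
    ldpcPairWeight G l ω ≤ Real.exp (∑ v ∈ A, l v * (spin (ω v).1 + spin (ω v).2 - 2)) *
      ldpcPairWeight G l (eraseReplicas A ω) := by
  subst hA
  set A := replicaCluster G i ω with hA
  have hexp : ∏ v, Real.exp (l v * (spin (ω v).1 + spin (ω v).2)) =
      Real.exp (∑ v ∈ A, l v * (spin (ω v).1 + spin (ω v).2 - 2)) *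
      ∏ v, Real.exp (l v * (spin (eraseReplicas A ω v).1 + spin (eraseReplicas A ω v).2)) := by
    rw [← Real.exp_sum, ← Real.exp_sum, ← Real.exp_add]
    congr 1
    have : ∑ v ∈ A, l v * (spin (ω v).1 + spin (ω v).2 - 2) =
        ∑ v, if v ∈ A then l v * (spin (ω v).1 + spin (ω v).2 - 2) else 0 := by
      rw [Finset.sum_ite_mem, Finset.univ_inter]
    rw [this, ← Finset.sum_add_distrib]
    refine Finset.sum_congr rfl fun v _ => ?_
    by_cases h : v ∈ A
    · simp only [eraseReplicas, h, if_true, Prod.fst_one, Prod.snd_one, spin_one]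
      ring
    · simp [eraseReplicas, h]
  have hpar : ∏ c, parityFactor G c (fun v => (ω v).1) * parityFactor G c (fun v => (ω v).2) ≤
      ∏ c, parityFactor G c (fun v => (eraseReplicas A ω v).1) *
        parityFactor G c (fun v => (eraseReplicas A ω v).2) := by
    refine Finset.prod_le_prod (fun c _ =>
      mul_nonneg (parityFactor_nonneg _ _ _) (parityFactor_nonneg _ _ _)) fun c _ => ?_
    rcases check_dichotomy G i ω c with h | h
    · have hs : ∀ v ∈ G.checkNbhd c, eraseReplicas A ω v = ω v := fun v hv => by
        simp [eraseReplicas, hA, h v hv]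
      rw [parityFactor_congr G (y := fun v => (eraseReplicas A ω v).1)
          fun v hv => by rw [hs v hv],
        parityFactor_congr G (x := fun v => (ω v).2) (y := fun v => (eraseReplicas A ω v).2)
          fun v hv => by rw [hs v hv]]
    · have hs : ∀ v ∈ G.checkNbhd c, eraseReplicas A ω v = 1 := fun v hv => by
        by_cases hvA : v ∈ A
        · simp [eraseReplicas, hvA]
        · simp [eraseReplicas, hvA, h v hv hvA]
      rw [parityFactor_congr G (x := fun v => (eraseReplicas A ω v).1) (y := fun _ => 1)
          fun v hv => by rw [hs v hv]; rfl,
        parityFactor_congr G (x := fun v => (eraseReplicas A ω v).2) (y := fun _ => 1)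
          fun v hv => by rw [hs v hv]; rfl, parityFactor_one, mul_one]
      exact mul_le_one₀ (parityFactor_le_one _ _ _) (parityFactor_nonneg _ _ _)
        (parityFactor_le_one _ _ _)
  rw [ldpcPairWeight_eq, ldpcPairWeight_eq, hexp]
  rw [mul_left_comm]
  refine mul_le_mul_of_nonneg_left ?_ (Real.exp_pos _).le
  exact mul_le_mul_of_nonneg_right hpar (Finset.prod_nonneg fun v _ => (Real.exp_pos _).le)

/-- Interpolation `min 1 (exp a) ≤ exp (θ a)`. It lowers the exponent in the site weights, since the
low noise condition controls `E[exp (-s l)]` only for small `s`. -/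
theorem le_exp_mul_of_le {T Z a θ : ℝ} (hZ : 0 ≤ Z) (h1 : T ≤ Z) (h2 : T ≤ Real.exp a * Z)
    (hθ : 0 ≤ θ) (hθ1 : θ ≤ 1) : T ≤ Real.exp (θ * a) * Z := by
  rcases le_total a 0 with ha | ha
  · refine h2.trans (mul_le_mul_of_nonneg_right (Real.exp_le_exp.2 ?_) hZ)
    nlinarith
  · have := Real.one_le_exp (mul_nonneg hθ ha)
    nlinarith

/-- The pairs of spins other than `(1, 1)`. -/
def excitedPairs : Finset (ℤˣ × ℤˣ) := {(1, -1), (-1, 1), (-1, -1)}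

theorem mem_excitedPairs {τ : ℤˣ × ℤˣ} : τ ∈ excitedPairs ↔ τ ≠ 1 := by
  revert τ; decide

/-- The weight of a site in the support of two replicas. -/
noncomputable def excitedWeight (s l : ℝ) : ℝ := 2 * Real.exp (-s * l) + Real.exp (-(2 * s) * l)

theorem sum_excitedPairs (s l : ℝ) :
    ∑ τ ∈ excitedPairs, Real.exp (s / 2 * (l * (spin τ.1 + spin τ.2 - 2))) =
      excitedWeight s l := by
  unfold excitedPairs excitedWeight
  rw [Finset.sum_insert (by decide), Finset.sum_insert (by decide), Finset.sum_singleton]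
  simp only [spin_neg, spin_one]
  ring_nf

open Classical in
-- Split according to the pattern `π` on `A`. For a fixed pattern erasure is injective, so the
-- erased weights sum to at most `Z`. Interpolating with the trivial bound `Z` at `θ = s / 2` and
-- summing over the three excited values at each site gives the product.
theorem sum_cluster_eq_le (G : BipartiteGraph V C) (l : V → ℝ) (i : V) (A : Finset V) {s : ℝ}
    (hs : 0 ≤ s) (hs2 : s ≤ 2) :
    ∑ ω with i ∈ replicaSupport ω ∧ replicaCluster G i ω = A, ldpcPairWeight G l ω ≤
      (∏ v ∈ A, excitedWeight s (l v)) * ∑ ω, ldpcPairWeight G l ω := by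
  set Z := ∑ ω, ldpcPairWeight G l ω with hZ
  have hZ0 : 0 ≤ Z := Finset.sum_nonneg fun ω _ => ldpcPairWeight_nonneg G l ω
  let t : V → Finset (ℤˣ × ℤˣ) := fun v => if v ∈ A then excitedPairs else {1}
  have hmaps : ∀ ω ∈ Finset.univ.filter
      (fun ω => i ∈ replicaSupport ω ∧ replicaCluster G i ω = A),
      restrictReplicas A ω ∈ Fintype.piFinset t := by
    intro ω hω
    obtain ⟨hi, hA⟩ := (Finset.mem_filter.1 hω).2
    rw [Fintype.mem_piFinset]
    intro v
    by_cases h : v ∈ A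
    · have : v ∈ replicaSupport ω := clusterOf_subset _ hi (by rw [← hA] at h; exact h)
      simpa [t, restrictReplicas, h, mem_excitedPairs] using mem_replicaSupport.1 this
    · simp [t, restrictReplicas, h]
  rw [← Finset.sum_fiberwise_of_maps_to hmaps]
  have hfib : ∀ π ∈ Fintype.piFinset t,
      ∑ ω ∈ (Finset.univ.filter (fun ω => i ∈ replicaSupport ω ∧ replicaCluster G i ω = A)).filter
        (fun ω => restrictReplicas A ω = π), ldpcPairWeight G l ω ≤
      (∏ v, if v ∈ A then Real.exp (s / 2 * (l v * (spin (π v).1 + spin (π v).2 - 2))) else 1)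
        * Z := by
    intro π _
    set F := (Finset.univ.filter (fun ω => i ∈ replicaSupport ω ∧ replicaCluster G i ω = A)).filter
        (fun ω => restrictReplicas A ω = π) with hF
    have hprod : (∏ v, if v ∈ A then
          Real.exp (s / 2 * (l v * (spin (π v).1 + spin (π v).2 - 2))) else 1) =
        Real.exp (s / 2 * ∑ v ∈ A, l v * (spin (π v).1 + spin (π v).2 - 2)) := by
      rw [Finset.prod_ite_mem, Finset.univ_inter, Finset.mul_sum, Real.exp_sum]
    have hF' : ∀ ω ∈ F, replicaCluster G i ω = A ∧ restrictReplicas A ω = π := fun ω hω => by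
      rw [hF, Finset.mem_filter, Finset.mem_filter] at hω
      exact ⟨hω.1.2.2, hω.2⟩
    have hval : ∀ ω ∈ F, ∀ v ∈ A, ω v = π v := fun ω hω v hv => by
      rw [← (hF' ω hω).2]; simp [restrictReplicas, hv]
    rw [hprod]
    refine le_exp_mul_of_le hZ0 ?_ ?_ (by linarith) (by linarith)
    · exact Finset.sum_le_univ_sum_of_nonneg fun ω => ldpcPairWeight_nonneg G l ω
    · calc ∑ ω ∈ F, ldpcPairWeight G l ω
          ≤ ∑ ω ∈ F, Real.exp (∑ v ∈ A, l v * (spin (π v).1 + spin (π v).2 - 2)) *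
              ldpcPairWeight G l (eraseReplicas A ω) := by
            refine Finset.sum_le_sum fun ω hω => ?_
            have := ldpcPairWeight_le_erase G l i ω A (hF' ω hω).1
            rwa [Finset.sum_congr rfl fun v hv => by rw [hval ω hω v hv]] at this
        _ = Real.exp (∑ v ∈ A, l v * (spin (π v).1 + spin (π v).2 - 2)) *
              ∑ ω ∈ F, ldpcPairWeight G l (eraseReplicas A ω) := by rw [Finset.mul_sum]
        _ ≤ _ := by
            refine mul_le_mul_of_nonneg_left ?_ (Real.exp_pos _).le
            rw [← Finset.sum_image (s := F) (g := eraseReplicas A)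
              (f := fun ω => ldpcPairWeight G l ω)]
            · exact Finset.sum_le_univ_sum_of_nonneg fun ω => ldpcPairWeight_nonneg G l ω
            · intro ω hω ω' hω' he
              funext v
              by_cases hv : v ∈ A
              · rw [hval ω hω v hv, hval ω' hω' v hv]
              · simpa [eraseReplicas, hv] using congrFun he v
  refine (Finset.sum_le_sum hfib).trans (le_of_eq ?_)
  rw [← Finset.sum_mul]
  congr 1
  rw [← Finset.prod_univ_sum t (fun v τ => if v ∈ A then
    Real.exp (s / 2 * (l v * (spin τ.1 + spin τ.2 - 2))) else 1),
    ← Finset.univ_inter A, ← Finset.prod_ite_mem, Finset.univ_inter]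
  refine Finset.prod_congr rfl fun v _ => ?_
  by_cases h : v ∈ A
  · simp only [t, h, if_true]
    exact sum_excitedPairs s (l v)
  · simp [t, h]

open Classical in
theorem abs_gibbsCov_ldpc_le (G : BipartiteGraph V C) (l : V → ℝ) (i j : V) {s : ℝ}
    (hs : 0 ≤ s) (hs2 : s ≤ 2) (𝒢 : Finset (Finset V))
    (h𝒢 : ∀ A, IsCluster G.varGraph i A → j ∈ A → A ∈ 𝒢) :
    |gibbsCov (ldpcWeight G l) (fun x => spin (x i)) (fun x => spin (x j))| ≤
      2 * ∑ A ∈ 𝒢, ∏ v ∈ A, excitedWeight s (l v) := by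
  have hw := sum_ldpcWeight_pos G l
  have hZ : 0 < ∑ ω, ldpcPairWeight G l ω := by
    have := sum_replicas fun x y => ldpcWeight G l x * ldpcWeight G l y
    rw [← Finset.sum_mul_sum] at this
    unfold ldpcPairWeight
    rw [this]
    exact mul_pos hw hw
  have hcov : gibbsCov (ldpcWeight G l) (fun x => spin (x i)) (fun x => spin (x j)) =
      (∑ ω, ldpcPhi i j ω * ldpcPairWeight G l ω) / (2 * ∑ ω, ldpcPairWeight G l ω) :=
    gibbsCov_eq_replicas _ _ _ hw.ne'
  rw [hcov, sum_ldpcPhi_mul_eq, abs_div, abs_of_pos (show (0 : ℝ) < 2 * _ by positivity),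
    div_le_iff₀ (by positivity)]
  calc |∑ ω, if i ∈ replicaSupport ω ∧ j ∈ replicaCluster G i ω then
          ldpcPhi i j ω * ldpcPairWeight G l ω else 0|
      ≤ ∑ ω, |if i ∈ replicaSupport ω ∧ j ∈ replicaCluster G i ω then
          ldpcPhi i j ω * ldpcPairWeight G l ω else 0| := Finset.abs_sum_le_sum_abs _ _
    _ ≤ ∑ ω, ∑ A ∈ 𝒢, if i ∈ replicaSupport ω ∧ replicaCluster G i ω = A then
          4 * ldpcPairWeight G l ω else 0 := by
        refine Finset.sum_le_sum fun ω _ => ?_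
        have hnn := ldpcPairWeight_nonneg G l ω
        have hterm : ∀ A ∈ 𝒢, 0 ≤ if i ∈ replicaSupport ω ∧ replicaCluster G i ω = A then
          4 * ldpcPairWeight G l ω else 0 := fun A _ => by
            split_ifs
            · positivity
            · exact le_rfl
        split_ifs with h
        · refine le_trans ?_ (Finset.single_le_sum hterm
            (h𝒢 (replicaCluster G i ω) (isCluster_clusterOf _ _ _) h.2))
          rw [if_pos ⟨h.1, rfl⟩, abs_mul, abs_of_nonneg hnn]
          exact mul_le_mul_of_nonneg_right (abs_spin_sub_mul_le _ _ _ _) hnn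
        · rw [abs_zero]
          exact Finset.sum_nonneg hterm
    _ = 4 * ∑ A ∈ 𝒢, ∑ ω with i ∈ replicaSupport ω ∧ replicaCluster G i ω = A,
          ldpcPairWeight G l ω := by
        rw [Finset.sum_comm, Finset.mul_sum]
        refine Finset.sum_congr rfl fun A _ => ?_
        rw [Finset.sum_filter, Finset.mul_sum]
        exact Finset.sum_congr rfl fun ω _ => by split_ifs <;> simp
    _ ≤ 4 * ∑ A ∈ 𝒢, (∏ v ∈ A, excitedWeight s (l v)) * ∑ ω, ldpcPairWeight G l ω := by
        gcongr with A _
        exact sum_cluster_eq_le G l i A hs hs2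
    _ = _ := by rw [← Finset.sum_mul]; ring

end LDPC

/-! ### Noise averages -/

section Averages

instance (W : SymmetricChannel) : IsProbabilityMeasure W.llrLaw := by
  have := W.isProbabilityMeasure 1
  refine Measure.isProbabilityMeasure_map (Measurable.aemeasurable ?_)
  unfold SymmetricChannel.halfLogLikelihood
  exact (Real.measurable_log.comp (Measure.measurable_rnDeriv _ _).ennreal_toReal).const_mul _

open Classical in
-- Independence turns each product of site weights into a power of the mean. Integrability is needed
-- only for the majorant.
theorem integral_abs_le_sum_pow {S ι : Type} [Fintype S] (μ : Measure ℝ) [IsProbabilityMeasure μ]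
    (F : (S → ℝ) → ℝ) (p : ℝ → ℝ) (hp : Integrable p μ) (𝒢 : Finset ι) (Γ : ι → Finset S) (M : ℝ)
    (h : ∀ l, |F l| ≤ M * ∑ t ∈ 𝒢, ∏ k ∈ Γ t, p (l k)) :
    ∫ l, |F l| ∂(Measure.pi fun _ : S => μ) ≤ M * ∑ t ∈ 𝒢, (∫ x, p x ∂μ) ^ (Γ t).card := by
  let f : ι → S → ℝ → ℝ := fun t k => if k ∈ Γ t then p else fun _ => 1
  have hf : ∀ t (l : S → ℝ), ∏ k ∈ Γ t, p (l k) = ∏ k, f t k (l k) := fun t l => by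
    rw [← Finset.univ_inter (Γ t), ← Finset.prod_ite_mem]
    refine Finset.prod_congr rfl fun k _ => ?_
    by_cases hk : k ∈ Γ t <;> simp [f, hk]
  have hint : ∀ t k, Integrable (f t k) μ := fun t k => by
    by_cases hk : k ∈ Γ t <;> simp [f, hk, hp]
  have hprod : ∀ t, Integrable (fun l : S → ℝ => ∏ k, f t k (l k)) (Measure.pi fun _ : S => μ) :=
    fun t => Integrable.fintype_prod fun k => hint t k
  have hval : ∀ t, ∫ l : S → ℝ, ∏ k, f t k (l k) ∂(Measure.pi fun _ : S => μ) =
      (∫ x, p x ∂μ) ^ (Γ t).card := fun t => by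
    rw [integral_fintype_prod_eq_prod, ← Finset.prod_const, ← Finset.univ_inter (Γ t),
      ← Finset.prod_ite_mem]
    refine Finset.prod_congr rfl fun k _ => ?_
    by_cases hk : k ∈ Γ t <;> simp [f, hk]
  simp only [hf] at h
  calc _ ≤ ∫ l : S → ℝ, M * ∑ t ∈ 𝒢, ∏ k, f t k (l k) ∂(Measure.pi fun _ : S => μ) :=
        integral_mono_of_nonneg (ae_of_all _ fun l => abs_nonneg _)
          ((integrable_finsetSum _ fun t _ => hprod t).const_mul _) (ae_of_all _ h)
    _ = _ := by
        rw [integral_const_mul, integral_finsetSum _ fun t _ => hprod t]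
        simp only [hval]

/-- The average strength of the interactions of an LDGM code. -/
noncomputable def mayerAverage (μ : Measure ℝ) : ℝ := ∫ l, (1 - Real.exp (-4 * |l|)) ∂μ

theorem integrable_one_sub_exp (μ : Measure ℝ) [IsProbabilityMeasure μ] :
    Integrable (fun l => 1 - Real.exp (-4 * |l|)) μ := by
  refine Integrable.of_bound (C := 1) (by fun_prop) (ae_of_all _ fun l => ?_)
  have h1 := Real.exp_pos (-4 * |l|)
  have h2 : Real.exp (-4 * |l|) ≤ 1 := Real.exp_le_one_iff.2 (by linarith [abs_nonneg l])
  rw [Real.norm_eq_abs, abs_le]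
  constructor <;> linarith

theorem mayerAverage_nonneg (μ : Measure ℝ) : 0 ≤ mayerAverage μ :=
  integral_nonneg fun l => by
    have h2 : Real.exp (-4 * |l|) ≤ 1 := Real.exp_le_one_iff.2 (by linarith [abs_nonneg l])
    simp only [Pi.zero_apply]
    linarith

theorem mayerAverage_le (μ : Measure ℝ) [IsProbabilityMeasure μ] {H : ℝ} (hH : 0 ≤ H) :
    mayerAverage μ ≤ Real.exp (4 * H) - 1 + μ.real {l | H < |l|} := by
  have hm : MeasurableSet {l : ℝ | H < |l|} := measurableSet_lt measurable_const (by fun_prop)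
  have hi : Integrable ({l : ℝ | H < |l|}.indicator fun _ => (1 : ℝ)) μ :=
    (integrable_const 1).indicator hm
  calc mayerAverage μ
      ≤ ∫ l, (Real.exp (4 * H) - 1) + {l : ℝ | H < |l|}.indicator (fun _ => (1 : ℝ)) l ∂μ := by
        refine integral_mono (integrable_one_sub_exp μ) ((integrable_const _).add hi) fun l => ?_
        -- Off the tail `1 - exp (-4 |l|) ≤ 4 |l| ≤ 4 H ≤ exp (4 H) - 1`; on the tail the integrand
        -- is at most `1`.
        have h0 := Real.add_one_le_exp (4 * H)
        by_cases h : H < |l|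
        · have h1 := Real.exp_pos (-4 * |l|)
          simp only [Set.indicator, Set.mem_ofPred_eq, h, if_true]
          linarith
        · have h1 := Real.add_one_le_exp (-4 * |l|)
          simp only [Set.indicator, Set.mem_ofPred_eq, h, if_false]
          linarith
    _ = _ := by
        rw [integral_add (integrable_const _) hi, integral_indicator_const _ hm]
        simp

/-- The average weight of a site in the support of two replicas of an LDPC code. -/
noncomputable def excitedAverage (s : ℝ) (μ : Measure ℝ) : ℝ := ∫ l, excitedWeight s l ∂μ

theorem excitedAverage_nonneg (s : ℝ) (μ : Measure ℝ) : 0 ≤ excitedAverage s μ :=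
  integral_nonneg fun l => by unfold excitedWeight; positivity

theorem integrable_exp_neg_mul {μ : Measure ℝ}
    (h : ∀ m : ℝ, 0 < m → Integrable (fun l => Real.exp (m * |l|)) μ) {s : ℝ} (hs : 0 < s) :
    Integrable (fun l => Real.exp (-s * l)) μ := by
  refine (h s hs).mono' (by fun_prop) (ae_of_all _ fun l => ?_)
  rw [Real.norm_eq_abs, Real.abs_exp]
  refine Real.exp_le_exp.2 ?_
  nlinarith [neg_abs_le l]

theorem excitedAverage_eq {μ : Measure ℝ}
    (h : ∀ m : ℝ, 0 < m → Integrable (fun l => Real.exp (m * |l|)) μ) {s : ℝ} (hs : 0 < s) :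
    excitedAverage s μ =
      2 * ∫ l, Real.exp (-s * l) ∂μ + ∫ l, Real.exp (-(2 * s) * l) ∂μ := by
  unfold excitedAverage excitedWeight
  rw [integral_add ((integrable_exp_neg_mul h hs).const_mul 2)
    (integrable_exp_neg_mul h (by positivity)), integral_const_mul]

theorem integrable_excitedWeight {μ : Measure ℝ}
    (h : ∀ m : ℝ, 0 < m → Integrable (fun l => Real.exp (m * |l|)) μ) {s : ℝ} (hs : 0 < s) :
    Integrable (excitedWeight s) μ :=
  ((integrable_exp_neg_mul h hs).const_mul 2).add (integrable_exp_neg_mul h (by positivity))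

end Averages

/-! ### Exponential decay at fixed noise -/

section Decay

variable {V C : Type} [Fintype V]

theorem ldgmPhi_eq_zero (G : BipartiteGraph V C) {i : C} (hi : G.checkNbhd i = ∅) (j : C)
    (ω : V → ℤˣ × ℤˣ) : ldgmPhi G i j ω = 0 := by
  simp [ldgmPhi, ldgmBit, hi]

variable [Fintype C]

open Classical in
theorem ldgmAvgCorr_le_two (W : SymmetricChannel) (G : BipartiteGraph V C) (i j : C) :
    ldgmAvgCorr W G i j ≤ 2 := by
  -- A single empty set `Γ` is contained in every `S`, so nothing has to vanish and the expansion
  -- returns the trivial bound.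
  have := integral_abs_le_sum_pow W.llrLaw _ _ (integrable_one_sub_exp _) {()} (fun _ => ∅) 2
    fun l => abs_gibbsCov_ldgm_le G l i j {()} (fun _ => ∅) (by simp)
  simpa [ldgmAvgCorr] using this

open Classical in
theorem ldgmAvgCorr_le_zero (W : SymmetricChannel) (G : BipartiteGraph V C) {i : C}
    (hi : G.checkNbhd i = ∅) (j : C) : ldgmAvgCorr W G i j ≤ 0 := by
  have := integral_abs_le_sum_pow W.llrLaw _ _ (integrable_one_sub_exp _) (∅ : Finset Unit)
    (fun _ => ∅) 2 fun l => abs_gibbsCov_ldgm_le G l i j (∅ : Finset Unit) (fun _ => ∅)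
      (by simp [ldgmPhi_eq_zero G hi])
  simpa [ldgmAvgCorr] using this

open Classical in
theorem ldgmAvgCorr_le_of_nbhd_ne (W : SymmetricChannel) (G : BipartiteGraph V C) {lmax : ℕ}
    (hl : ∀ v, (G.varNbhd v).card ≤ lmax) {i j : C} (hij : G.checkNbhd i ≠ G.checkNbhd j) :
    ldgmAvgCorr W G i j ≤ 2 * (lmax * mayerAverage W.llrLaw) := by
  obtain ⟨a, ha⟩ : ∃ a, ¬ (a ∈ G.checkNbhd i ↔ a ∈ G.checkNbhd j) := by
    by_contra! h
    exact hij (Finset.ext h)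
  have := integral_abs_le_sum_pow W.llrLaw _ _ (integrable_one_sub_exp _) (G.varNbhd a)
    (fun k => {k}) 2 fun l => abs_gibbsCov_ldgm_le G l i j (G.varNbhd a) (fun k => {k})
      fun S hS => ldgm_vanish_of_untouched G l i j S a ha fun k hk hak => hS k
        (by simpa [BipartiteGraph.varNbhd, BipartiteGraph.checkNbhd] using hak) (by simpa using hk)
  refine this.trans ?_
  simp only [Finset.card_singleton, pow_one, Finset.sum_const, nsmul_eq_mul]
  have h1 : ((G.varNbhd a).card : ℝ) ≤ lmax := by exact_mod_cast hl a
  have h2 := mayerAverage_nonneg W.llrLaw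
  unfold mayerAverage at h2 ⊢
  gcongr

open Classical in
theorem ldgmAvgCorr_le_of_dist (W : SymmetricChannel) (G : BipartiteGraph V C) {lmax kmax Δ : ℕ}
    (hG : G.DegreesBounded lmax kmax) (hΔ : kmax * lmax ≤ Δ) {r : ℝ} (hr : 0 ≤ r)
    (hq1 : mayerAverage W.llrLaw ≤ 1)
    (hq : (Δ : ℝ) ^ 2 * √(mayerAverage W.llrLaw) ≤ 1 / 2 * Real.exp (-2 * r)) {i j : C} {d : ℕ}
    (hd : (d : ℕ∞) ≤ G.tannerGraph.edist (Sum.inr i) (Sum.inr j)) (hd3 : 3 ≤ d) :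
    ldgmAvgCorr W G i j ≤ 4 * Real.exp (-r * d) := by
  have hdist : ∀ A, IsCluster G.checkGraph i A → j ∈ A → A ∈ largeClusters G.checkGraph i d := by
    intro A hA hj
    simp only [largeClusters, Finset.mem_filter, Finset.mem_univ, true_and]
    refine ⟨hA, ?_⟩
    obtain ⟨p, hp⟩ := hA.exists_walk hj
    have := hd.trans (edist_le_two_mul_length G.tannerGraph (fun c v => G.Adj v c) Sum.inr Sum.inl
      (fun c v h => (SimpleGraph.fromRel_adj _ _ _).2 ⟨by simp, Or.inr ⟨v, c, rfl, rfl, h⟩⟩) p)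
    have : d ≤ 2 * p.length := by exact_mod_cast this
    omega
  set q := mayerAverage W.llrLaw with hqdef
  have hq0 : 0 ≤ q := mayerAverage_nonneg _
  have hdeg : ∀ v, (G.checkGraph.neighborFinset v).card ≤ Δ := fun v => by
    refine le_trans ?_ hΔ
    exact card_neighborFinset_shareGraph_le (fun c v => G.Adj v c) (k := kmax) (l := lmax)
      hG.2 hG.1 v
  -- The sites `i` and `j` were adjoined to `S` by hand, so only the rest of the cluster must lie in
  -- `S`.
  have := integral_abs_le_sum_pow W.llrLaw _ _ (integrable_one_sub_exp _)
    (largeClusters G.checkGraph i d) (fun A => A \ {i, j}) 2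
    fun l => abs_gibbsCov_ldgm_le G l i j (largeClusters G.checkGraph i d) (fun A => A \ {i, j})
      fun S hS => ldgm_vanish_of_not_connected G l i j S fun hj =>
        hS _ (hdist _ (isCluster_clusterOf _ _ _) hj) fun k hk => by
          rw [Finset.mem_sdiff] at hk
          have := clusterOf_subset _ (Finset.mem_insert_self _ _) hk.1
          simp only [Finset.mem_insert, Finset.mem_singleton] at this hk
          tauto
  refine this.trans ?_
  have hsum : ∑ A ∈ largeClusters G.checkGraph i d, q ^ (A \ {i, j}).card ≤
      ∑ A ∈ largeClusters G.checkGraph i d, √q ^ (A.card - 1) := by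
    refine Finset.sum_le_sum fun A hA => ?_
    simp only [largeClusters, Finset.mem_filter, Finset.mem_univ, true_and] at hA
    -- As `d ≥ 3`, the cluster has at least three sites, so `2 (|A| - 2) ≥ |A| - 1`. Replacing `q`
    -- by `√q` thus pays for the two lost sites.
    have h1 := Finset.le_card_sdiff {i, j} A
    have h2 := Finset.card_le_two (a := i) (b := j)
    calc q ^ (A \ {i, j}).card = √q ^ (2 * (A \ {i, j}).card) := by
          rw [pow_mul, Real.sq_sqrt hq0]
      _ ≤ _ := pow_le_pow_of_le_one (Real.sqrt_nonneg _) (Real.sqrt_le_one.2 hq1) (by omega)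
  have := sum_largeClusters_le G.checkGraph hdeg i d (Real.sqrt_nonneg q) hr hq
  change 2 * ∑ A ∈ largeClusters G.checkGraph i d, q ^ (A \ {i, j}).card ≤ _
  linarith

/-- For `d ≤ 2` and distinct neighbourhoods the bound `2 * lmax * q` suffices: `lmax ≤ Δ²` and `q ≤
√q` bring it under `exp (-2 r)`. The summand `lmax` in the condition on `Δ` serves this case. -/
theorem ldgmAvgCorr_le (W : SymmetricChannel) (G : BipartiteGraph V C) {lmax kmax Δ : ℕ}
    (hG : G.DegreesBounded lmax kmax) (hΔ : kmax * lmax + lmax + 1 ≤ Δ) {r : ℝ} (hr : 0 ≤ r)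
    (hq1 : mayerAverage W.llrLaw ≤ 1)
    (hq : (Δ : ℝ) ^ 2 * √(mayerAverage W.llrLaw) ≤ 1 / 2 * Real.exp (-2 * r)) {i j : C} {d : ℕ}
    (hd : (d : ℕ∞) ≤ G.tannerGraph.edist (Sum.inr i) (Sum.inr j))
    (hij : G.checkNbhd i = G.checkNbhd j → i = j) :
    ldgmAvgCorr W G i j ≤ 16 * Real.exp (-r * d) := by
  by_cases hd3 : 3 ≤ d
  · have := ldgmAvgCorr_le_of_dist W G hG (by omega) hr hq1 hq hd hd3
    linarith [Real.exp_pos (-r * d)]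
  by_cases hnb : G.checkNbhd i = G.checkNbhd j
  · obtain rfl := hij hnb
    obtain rfl : d = 0 := by simpa using hd
    have := ldgmAvgCorr_le_two W G i i
    simp only [Nat.cast_zero, mul_zero, Real.exp_zero]
    linarith
  · have h1 := ldgmAvgCorr_le_of_nbhd_ne W G hG.1 hnb
    have hq0 := mayerAverage_nonneg W.llrLaw
    have h2 : mayerAverage W.llrLaw ≤ √(mayerAverage W.llrLaw) :=
      Real.le_sqrt_of_sq_le (by nlinarith)
    have h3 : (lmax : ℝ) ≤ (Δ : ℝ) ^ 2 := by
      exact_mod_cast (show lmax ≤ Δ ^ 2 by nlinarith [Nat.zero_le (kmax * lmax)])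
    have h4 : lmax * mayerAverage W.llrLaw ≤ (Δ : ℝ) ^ 2 * √(mayerAverage W.llrLaw) :=
      mul_le_mul h3 h2 hq0 (by positivity)
    have h5 : Real.exp (-2 * r) ≤ Real.exp (-r * d) := by
      have : (d : ℝ) ≤ 2 := by exact_mod_cast (by omega : d ≤ 2)
      exact Real.exp_le_exp.2 (by nlinarith)
    linarith [Real.exp_pos (-r * d)]

theorem ldgmAvgCorr_le_of_nbhd_eq (W : SymmetricChannel) (G : BipartiteGraph V C) {i j : C} {d : ℕ}
    (hd : (d : ℕ∞) ≤ G.tannerGraph.edist (Sum.inr i) (Sum.inr j))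
    (hij : G.checkNbhd i = G.checkNbhd j) {x : ℝ} (hx : 1 ≤ x) :
    ldgmAvgCorr W G i j ≤ 16 * Real.exp (-(d : ℝ) / x) := by
  rcases Finset.eq_empty_or_nonempty (G.checkNbhd i) with h | ⟨a, ha⟩
  · exact (ldgmAvgCorr_le_zero W G h j).trans (by positivity)
  · have hai : G.Adj a i := by simpa [BipartiteGraph.checkNbhd] using ha
    have haj : G.Adj a j := by
      rw [hij] at ha
      simpa [BipartiteGraph.checkNbhd] using ha
    have hadj : ∀ c, G.Adj a c → G.tannerGraph.Adj (Sum.inr c) (Sum.inl a) := fun c h =>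
      (SimpleGraph.fromRel_adj _ _ _).2 ⟨by simp, Or.inr ⟨a, c, rfl, rfl, h⟩⟩
    have h2 : G.tannerGraph.edist (Sum.inr i) (Sum.inr j) ≤ ((2 : ℕ) : ℕ∞) :=
      SimpleGraph.edist_le (.cons (hadj i hai) (.cons (hadj j haj).symm .nil))
    have hd2 : d ≤ 2 := by exact_mod_cast hd.trans h2
    have hd2' : (d : ℝ) ≤ 2 := by exact_mod_cast hd2
    have h3 : (d : ℝ) / x ≤ 2 := (div_le_self (by positivity) hx).trans hd2'
    have h4 : Real.exp (-2) ≤ Real.exp (-(d : ℝ) / x) := by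
      rw [neg_div]
      exact Real.exp_le_exp.2 (by linarith)
    -- Equal nonempty neighbourhoods put `i` and `j` at distance at most two; the constant `16`
    -- covers this case, through `exp 2 ≤ 8`.
    have h5 : 2 ≤ 16 * Real.exp (-2) := by
      have := Real.exp_one_lt_d9
      have h6 : Real.exp 2 ≤ 8 := by
        rw [show (2 : ℝ) = 1 + 1 by norm_num, Real.exp_add]
        nlinarith [Real.exp_pos 1]
      rw [Real.exp_neg]
      have : (8 : ℝ)⁻¹ ≤ (Real.exp 2)⁻¹ := inv_anti₀ (Real.exp_pos _) h6
      linarith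
    linarith [ldgmAvgCorr_le_two W G i j]

open Classical in
theorem ldpcAvgCorr_le (W : SymmetricChannel) (G : BipartiteGraph V C) {lmax kmax : ℕ}
    (hG : G.DegreesBounded lmax kmax) {r s : ℝ} (hr : 0 ≤ r) (hs : 0 < s) (hs2 : s ≤ 2)
    (hW : ∀ m : ℝ, 0 < m → Integrable (fun l => Real.exp (m * |l|)) W.llrLaw)
    (hq1 : excitedAverage s W.llrLaw ≤ 1)
    (hq : ((lmax * kmax : ℕ) : ℝ) ^ 2 * excitedAverage s W.llrLaw ≤ 1 / 2 * Real.exp (-2 * r))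
    {i j : V} {d : ℕ} (hd : (d : ℕ∞) ≤ G.tannerGraph.edist (Sum.inl i) (Sum.inl j)) :
    ldpcAvgCorr W G i j ≤ 16 * Real.exp (-r * d) := by
  have hdist : ∀ A, IsCluster G.varGraph i A → j ∈ A → A ∈ largeClusters G.varGraph i d := by
    intro A hA hj
    simp only [largeClusters, Finset.mem_filter, Finset.mem_univ, true_and]
    refine ⟨hA, ?_⟩
    obtain ⟨p, hp⟩ := hA.exists_walk hj
    have := hd.trans (edist_le_two_mul_length G.tannerGraph (fun v c => G.Adj v c) Sum.inl Sum.inr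
      (fun v c h => (SimpleGraph.fromRel_adj _ _ _).2 ⟨by simp, Or.inl ⟨v, c, rfl, rfl, h⟩⟩) p)
    have : d ≤ 2 * p.length := by exact_mod_cast this
    omega
  set q := excitedAverage s W.llrLaw with hqdef
  have hq0 : 0 ≤ q := excitedAverage_nonneg _ _
  have hdeg : ∀ v, (G.varGraph.neighborFinset v).card ≤ lmax * kmax := fun v => by
    exact card_neighborFinset_shareGraph_le (fun v c => G.Adj v c) (k := lmax) (l := kmax)
      hG.1 hG.2 v
  have := integral_abs_le_sum_pow W.llrLaw _ _ (integrable_excitedWeight hW hs)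
    (largeClusters G.varGraph i d) (fun A => A) 2
    fun l => abs_gibbsCov_ldpc_le G l i j hs.le hs2 (largeClusters G.varGraph i d) hdist
  refine this.trans ?_
  have hsum : ∑ A ∈ largeClusters G.varGraph i d, q ^ A.card ≤
      ∑ A ∈ largeClusters G.varGraph i d, q ^ (A.card - 1) :=
    Finset.sum_le_sum fun A _ => pow_le_pow_of_le_one hq0 hq1 (by omega)
  have := sum_largeClusters_le G.varGraph hdeg i d hq0 hr hq
  change 2 * ∑ A ∈ largeClusters G.varGraph i d, q ^ A.card ≤ _
  linarith [Real.exp_pos (-r * d)]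

end Decay

/-! ### Monotone decay rates -/

section Rates

/-- Diagonal choice: at height `x` take the largest integer rate `n ≤ x` whose threshold `R n` has
been passed. No monotonicity of `P` in the rate is required. -/
theorem exists_monotone_rate (P : ℝ → ℝ → Prop) (D : Set ℝ) (h : ℝ → ℝ)
    (hP : ∀ r : ℝ, ∃ R : ℝ, ∀ ε ∈ D, R ≤ h ε → P ε r) :
    ∃ (x₀ : ℝ) (g : ℝ → ℝ), Monotone g ∧ Tendsto g atTop atTop ∧ (∀ x, x₀ ≤ x → 0 < g x) ∧
      ∀ ε ∈ D, x₀ ≤ h ε → P ε (g (h ε)) := by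
  classical
  choose R hR using hP
  let N : ℝ → ℕ := fun x => Nat.findGreatest (fun n => R n ≤ x) ⌊x⌋₊
  have hNspec : ∀ x, 1 ≤ x → R (1 : ℕ) ≤ x → R (N x) ≤ x := fun x hx h1 =>
    Nat.findGreatest_spec (P := fun n : ℕ => R n ≤ x) (Nat.one_le_floor_iff x |>.2 hx) h1
  -- From this point on `n = 1` qualifies, so `N x` is a genuine positive witness and not the
  -- default value `0` of `Nat.findGreatest`.
  refine ⟨max 1 (R (1 : ℕ)), fun x => N x, ?_, ?_, ?_, ?_⟩
  · intro x y hxy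
    exact Nat.cast_le.2 (Nat.findGreatest_mono (fun n hn => hn.trans hxy) (Nat.floor_mono hxy))
  · refine tendsto_atTop.2 fun b => ?_
    obtain ⟨n, hn⟩ := exists_nat_ge b
    filter_upwards [eventually_ge_atTop (max (n : ℝ) (R n))] with x hx
    refine hn.trans (Nat.cast_le.2 (Nat.le_findGreatest ?_ ((le_max_right _ _).trans hx)))
    exact Nat.le_floor ((le_max_left _ _).trans hx)
  · intro x hx
    have : 1 ≤ N x := Nat.le_findGreatest
      (Nat.one_le_floor_iff x |>.2 ((le_max_left _ _).trans hx)) ((le_max_right _ _).trans hx)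
    exact Nat.cast_pos.2 this
  · intro ε hε hx
    exact hR _ ε hε (hNspec _ ((le_max_left _ _).trans hx) ((le_max_right _ _).trans hx))

theorem eventually_towardsMax {εmax : EReal} {a : EReal} (ha : a < εmax) :
    ∀ᶠ ε : ℝ in towardsMax εmax, a < ε ∧ (ε : EReal) < εmax :=
  Filter.preimage_mem_comap (Ioo_mem_nhdsLT ha)

theorem exists_of_eventually_towardsMax {εmax : EReal} (h0 : 0 < εmax) {P : ℝ → Prop}
    (h : ∀ᶠ ε in towardsMax εmax, P ε) :
    ∃ a : EReal, a < εmax ∧ ∀ ε : ℝ, a < ε → (ε : EReal) < εmax → P ε := by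
  obtain ⟨s, hs, hsP⟩ := Filter.mem_comap.1 h
  obtain ⟨a, ha, has⟩ := (mem_nhdsLT_iff_exists_Ioo_subset' h0).1 hs
  exact ⟨a, ha, fun ε h1 h2 => hsP (has ⟨h1, h2⟩)⟩

theorem exists_pos_real_lt {εmax : EReal} (h0 : 0 < εmax) : ∃ a : ℝ, 0 < a ∧ (a : EReal) < εmax := by
  obtain ⟨a, h1, h2⟩ := EReal.lt_iff_exists_real_btwn.1 h0
  exact ⟨a, by exact_mod_cast h1, h2⟩

/-- A monotone reparametrization of `(-∞, εmax)` that tends to infinity exactly at `εmax`. -/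
theorem exists_height {εmax : EReal} (h0 : 0 < εmax) :
    ∃ h : ℝ → ℝ, MonotoneOn h {ε : ℝ | (ε : EReal) < εmax} ∧
      (∀ R : ℝ, ∃ a : ℝ, 0 < a ∧ (a : EReal) < εmax ∧
        ∀ ε : ℝ, a < ε → (ε : EReal) < εmax → R ≤ h ε) ∧
      ∀ a : EReal, a < εmax → ∃ R : ℝ, ∀ ε : ℝ, (ε : EReal) < εmax → R ≤ h ε → a < ε := by
  induction εmax with
  | bot => simp at h0
  | top =>
    refine ⟨id, fun _ _ _ _ h => h, fun R => ⟨max R 1, by positivity, EReal.coe_lt_top _,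
      fun ε h _ => (le_max_left _ _).trans h.le⟩, fun a ha => ?_⟩
    obtain ⟨R, hR, -⟩ := EReal.lt_iff_exists_real_btwn.1 ha
    exact ⟨R, fun ε _ h => hR.trans_le (EReal.coe_le_coe_iff.2 h)⟩
  | coe b =>
    have hb : 0 < b := by exact_mod_cast h0
    refine ⟨fun ε => (b - ε)⁻¹, ?_, fun R => ?_, fun a ha => ?_⟩
    · intro x hx y hy hxy
      have hy' : y < b := by exact_mod_cast hy
      exact inv_anti₀ (by linarith) (by linarith)
    · have hR : 0 < (max R 1)⁻¹ := by positivity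
      refine ⟨max (b / 2) (b - (max R 1)⁻¹), lt_of_lt_of_le (by linarith) (le_max_left _ _),
        EReal.coe_lt_coe_iff.2 (max_lt (by linarith) (by linarith)), fun ε h1 h2 => ?_⟩
      have h2' : ε < b := by exact_mod_cast h2
      have h3 := (le_max_right _ _).trans_lt h1
      refine (le_max_left R 1).trans ?_
      rw [le_inv_comm₀ (by positivity) (by linarith)]
      linarith
    · obtain ⟨c, hac, hcb⟩ := EReal.lt_iff_exists_real_btwn.1 ha
      have hcb' : c < b := by exact_mod_cast hcb
      refine ⟨(b - c)⁻¹, fun ε h1 h2 => hac.trans_le (EReal.coe_le_coe_iff.2 ?_)⟩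
      have h1' : ε < b := by exact_mod_cast h1
      have := (inv_le_inv₀ (by linarith) (by linarith)).1 h2
      linarith

end Rates

/-! ### Smallness near the ends of the noise interval -/

section Limits

variable {εmax : EReal} {W : ℝ → SymmetricChannel}

theorem ClassK.tendsto_mayerAverage (hW : ClassK εmax W) :
    Tendsto (fun ε => mayerAverage (W ε).llrLaw) (towardsMax εmax) (𝓝 0) := by
  obtain ⟨H, hH, hlim⟩ := hW.high_noise
  refine squeeze_zero' (Eventually.of_forall fun ε => mayerAverage_nonneg _) ?_ hlim
  filter_upwards [eventually_towardsMax hW.εmax_pos] with ε hε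
  exact mayerAverage_le _ (hH ε (by exact_mod_cast hε.1) hε.2).le

theorem ClassK.exists_tendsto_excitedAverage (hW : ClassK εmax W) :
    ∃ s : ℝ, 0 < s ∧ s ≤ 2 ∧
      Tendsto (fun ε => excitedAverage s (W ε).llrLaw) (𝓝[>] 0) (𝓝 0) := by
  obtain ⟨s₀, hs₀, hlim⟩ := hW.low_noise
  obtain ⟨a, ha, haε⟩ := exists_pos_real_lt hW.εmax_pos
  have hs : 0 < min (s₀ / 2) 2 := by positivity
  -- Both exponents `s` and `2 s` of the site weight must stay within `s₀`, and `s ≤ 2` keeps the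
  -- interpolation parameter `s / 2` in `[0, 1]`.
  have hs1 := min_le_left (s₀ / 2) 2
  refine ⟨min (s₀ / 2) 2, hs, min_le_right _ _, ?_⟩
  have h := ((hlim _ hs (by linarith)).const_mul 2).add
    (hlim (2 * min (s₀ / 2) 2) (by positivity) (by linarith))
  rw [mul_zero, add_zero] at h
  refine h.congr' ?_
  filter_upwards [Ioo_mem_nhdsGT ha] with ε hε
  exact (excitedAverage_eq (hW.exp_moments ε hε.1
    ((EReal.coe_lt_coe_iff.2 hε.2).trans haε)) hs).symm

/-- The decay estimate with rate `r` for all LDGM codes of bounded degrees. -/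
def LdgmDecay (W : SymmetricChannel) (lmax kmax : ℕ) (r : ℝ) : Prop :=
  ∀ (n m : ℕ) (G : BipartiteGraph (Fin m) (Fin n)), G.DegreesBounded lmax kmax →
    ∀ (i j : Fin n) (d : ℕ), (d : ℕ∞) ≤ G.tannerGraph.edist (Sum.inr i) (Sum.inr j) →
      (G.checkNbhd i = G.checkNbhd j → i = j) → ldgmAvgCorr W G i j ≤ 16 * Real.exp (-r * d)

/-- The decay estimate with rate `r` for all LDPC codes of bounded degrees. -/
def LdpcDecay (W : SymmetricChannel) (lmax kmax : ℕ) (r : ℝ) : Prop :=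
  ∀ (n m : ℕ) (G : BipartiteGraph (Fin n) (Fin m)), G.DegreesBounded lmax kmax →
    ∀ (i j : Fin n) (d : ℕ), (d : ℕ∞) ≤ G.tannerGraph.edist (Sum.inl i) (Sum.inl j) →
      ldpcAvgCorr W G i j ≤ 16 * Real.exp (-r * d)

/-- The decay estimates need a nonnegative rate, while the diagonal choice asks for every real one;
negative rates are covered by rate `0`. -/
theorem exp_neg_max_mul_le (r : ℝ) (d : ℕ) :
    Real.exp (-max r 0 * d) ≤ Real.exp (-r * d) := by
  have := mul_le_mul_of_nonneg_right (le_max_left r 0) (Nat.cast_nonneg (α := ℝ) d)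
  exact Real.exp_le_exp.2 (by linarith)

theorem ClassK.eventually_ldgmDecay (hW : ClassK εmax W) (lmax kmax : ℕ) (r : ℝ) :
    ∀ᶠ ε in towardsMax εmax, LdgmDecay (W ε) lmax kmax r := by
  set Δ := kmax * lmax + lmax + 1 with hΔ
  have h1 := hW.tendsto_mayerAverage
  have h2 : Tendsto (fun ε => (Δ : ℝ) ^ 2 * √(mayerAverage (W ε).llrLaw)) (towardsMax εmax)
      (𝓝 0) := by
    simpa using ((Real.continuous_sqrt.tendsto 0).comp h1).const_mul ((Δ : ℝ) ^ 2)
  filter_upwards [h1.eventually_le_const one_pos,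
    h2.eventually_le_const (show 0 < 1 / 2 * Real.exp (-2 * max r 0) by positivity)]
    with ε hε1 hε2 n m G hG i j d hd hij
  refine (ldgmAvgCorr_le (W ε) G hG le_rfl (le_max_right r 0) hε1 hε2 hd hij).trans ?_
  linarith [exp_neg_max_mul_le r d]

theorem ClassK.eventually_ldpcDecay (hW : ClassK εmax W) (lmax kmax : ℕ) (r : ℝ) :
    ∀ᶠ ε in 𝓝[>] 0, LdpcDecay (W ε) lmax kmax r := by
  obtain ⟨s, hs, hs2, h1⟩ := hW.exists_tendsto_excitedAverage
  obtain ⟨a, ha, haε⟩ := exists_pos_real_lt hW.εmax_pos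
  have h2 := h1.const_mul (((lmax * kmax : ℕ) : ℝ) ^ 2)
  rw [mul_zero] at h2
  filter_upwards [h1.eventually_le_const one_pos, Ioo_mem_nhdsGT ha,
    h2.eventually_le_const (show 0 < 1 / 2 * Real.exp (-2 * max r 0) by positivity)]
    with ε hε1 hε hε2 n m G hG i j d hd
  refine (ldpcAvgCorr_le (W ε) G hG (le_max_right r 0) hs hs2 (hW.exp_moments ε hε.1
    ((EReal.coe_lt_coe_iff.2 hε.2).trans haε)) hε1 hε2 hd).trans ?_
  linarith [exp_neg_max_mul_le r d]

theorem ClassK.exists_ldgm_rate (hW : ClassK εmax W) (lmax kmax : ℕ) :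
    ∃ εg : ℝ, 0 < εg ∧ (εg : EReal) < εmax ∧ ∃ g : ℝ → ℝ,
      (∀ ε : ℝ, εg < ε → (ε : EReal) < εmax → 0 < g ε) ∧
      MonotoneOn g {ε : ℝ | εg < ε ∧ (ε : EReal) < εmax} ∧
      Tendsto g (towardsMax εmax) atTop ∧
      ∀ ε : ℝ, εg < ε → (ε : EReal) < εmax → LdgmDecay (W ε) lmax kmax (g ε) := by
  obtain ⟨h, hmono, hlarge, hsmall⟩ := exists_height hW.εmax_pos
  obtain ⟨x₀, g, hg, hglim, hgpos, hgP⟩ := exists_monotone_rate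
    (fun ε r => LdgmDecay (W ε) lmax kmax r) {ε : ℝ | (ε : EReal) < εmax} h fun r => by
      obtain ⟨a, ha, haP⟩ := exists_of_eventually_towardsMax hW.εmax_pos
        (hW.eventually_ldgmDecay lmax kmax r)
      obtain ⟨R, hR⟩ := hsmall a ha
      exact ⟨R, fun ε hε hRε => haP ε (hR ε hε hRε) hε⟩
  obtain ⟨εg, h0, hmax, hεg⟩ := hlarge x₀
  refine ⟨εg, h0, hmax, fun ε => g (h ε), fun ε h1 h2 => hgpos _ (hεg ε h1 h2),
    fun x hx y hy hxy => hg (hmono hx.2 hy.2 hxy), hglim.comp (tendsto_atTop.2 fun R => ?_),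
    fun ε h1 h2 => hgP ε h2 (hεg ε h1 h2)⟩
  obtain ⟨a, -, ha, haR⟩ := hlarge R
  filter_upwards [eventually_towardsMax ha] with ε hε
  exact haR ε (EReal.coe_lt_coe_iff.1 hε.1) hε.2

theorem ClassK.exists_ldpc_rate (hW : ClassK εmax W) (lmax kmax : ℕ) :
    ∃ εp : ℝ, 0 < εp ∧ (εp : EReal) < εmax ∧ ∃ g : ℝ → ℝ,
      (∀ ε : ℝ, 0 < ε → ε < εp → 0 < g ε) ∧
      AntitoneOn g (Set.Ioo 0 εp) ∧
      Tendsto g (𝓝[>] 0) atTop ∧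
      ∀ ε : ℝ, 0 < ε → ε < εp → LdpcDecay (W ε) lmax kmax (g ε) := by
  obtain ⟨x₀, g, hg, hglim, hgpos, hgP⟩ := exists_monotone_rate
    (fun ε r => LdpcDecay (W ε) lmax kmax r) (Set.Ioi 0) (fun ε => ε⁻¹) fun r => by
      obtain ⟨u, hu, huP⟩ := mem_nhdsGT_iff_exists_Ioo_subset.1
        (hW.eventually_ldpcDecay lmax kmax r)
      have hu0 : (0 : ℝ) < u := hu
      -- Adding `1` makes `ε < u` strict.
      refine ⟨u⁻¹ + 1, fun ε hε hR => huP ⟨hε, ?_⟩⟩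
      exact (inv_lt_inv₀ hu0 hε).1 (by linarith)
  obtain ⟨a, ha, haε⟩ := exists_pos_real_lt hW.εmax_pos
  have hle : ∀ ε : ℝ, 0 < ε → ε < min a (max x₀ 1)⁻¹ → x₀ ≤ ε⁻¹ := fun ε h0 h1 => by
    refine (le_max_left x₀ 1).trans ?_
    rw [le_inv_comm₀ (by positivity) h0]
    exact (h1.trans_le (min_le_right _ _)).le
  -- The bound `a` keeps `εp` below `εmax`; the other one ensures `ε⁻¹ ≥ x₀`.
  refine ⟨min a (max x₀ 1)⁻¹, by positivity,
    (EReal.coe_le_coe_iff.2 (min_le_left _ _)).trans_lt haε, fun ε => g ε⁻¹,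
    fun ε h0 h1 => hgpos _ (hle ε h0 h1), fun x hx y hy hxy => hg (inv_anti₀ hx.1 hxy),
    hglim.comp tendsto_inv_nhdsGT_zero, fun ε h0 h1 => hgP ε h0 (hle ε h0 h1)⟩

end Limits

end SparseCode

theorem theorem1 :
    ∃ c₁ : ℝ, 0 < c₁ ∧
      ∀ (εmax : EReal) (W : ℝ → SparseCode.SymmetricChannel), SparseCode.ClassK εmax W →
      ∀ lmax kmax : ℕ,
      -- LDGM codes at high noise
      (∃ εg : ℝ, 0 < εg ∧ (εg : EReal) < εmax ∧ ∃ ξ : ℝ → ℝ,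
        (∀ ε : ℝ, εg < ε → (ε : EReal) < εmax → 0 < ξ ε) ∧
        MonotoneOn (fun ε => (ξ ε)⁻¹) {ε : ℝ | εg < ε ∧ (ε : EReal) < εmax} ∧
        Tendsto (fun ε => (ξ ε)⁻¹) (SparseCode.towardsMax εmax) atTop ∧
        ∀ ε : ℝ, εg < ε → (ε : EReal) < εmax →
        ∀ (n m : ℕ) (G : SparseCode.BipartiteGraph (Fin m) (Fin n)), G.DegreesBounded lmax kmax →
        ∀ (i j : Fin n) (d : ℕ), (d : ℕ∞) ≤ G.tannerGraph.edist (Sum.inr i) (Sum.inr j) →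
          ((G.checkNbhd i = G.checkNbhd j → i = j) →
            SparseCode.ldgmAvgCorr (W ε) G i j ≤ c₁ * Real.exp (-(d : ℝ) / ξ ε)) ∧
          SparseCode.ldgmAvgCorr (W ε) G i j ≤ c₁ * Real.exp (-(d : ℝ) / max (ξ ε) 1)) ∧
      -- LDPC codes at low noise
      (∃ εp : ℝ, 0 < εp ∧ (εp : EReal) < εmax ∧ ∃ ξ : ℝ → ℝ,
        (∀ ε : ℝ, 0 < ε → ε < εp → 0 < ξ ε) ∧
        AntitoneOn (fun ε => (ξ ε)⁻¹) (Set.Ioo 0 εp) ∧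
        Tendsto (fun ε => (ξ ε)⁻¹) (𝓝[>] 0) atTop ∧
        ∀ ε : ℝ, 0 < ε → ε < εp →
        ∀ (n m : ℕ) (G : SparseCode.BipartiteGraph (Fin n) (Fin m)), G.DegreesBounded lmax kmax →
        ∀ (i j : Fin n) (d : ℕ), (d : ℕ∞) ≤ G.tannerGraph.edist (Sum.inl i) (Sum.inl j) →
          SparseCode.ldpcAvgCorr (W ε) G i j ≤ c₁ * Real.exp (-(d : ℝ) / ξ ε)) := by
  refine ⟨16, by norm_num, fun εmax W hW lmax kmax => ⟨?_, ?_⟩⟩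
  · obtain ⟨εg, h0, hmax, g, hpos, hmono, hlim, hdecay⟩ := hW.exists_ldgm_rate lmax kmax
    refine ⟨εg, h0, hmax, fun ε => (g ε)⁻¹, fun ε h1 h2 => inv_pos.2 (hpos ε h1 h2),
      by simpa only [inv_inv] using hmono, by simpa only [inv_inv] using hlim, ?_⟩
    intro ε h1 h2 n m G hG i j d hd
    have hfirst : (G.checkNbhd i = G.checkNbhd j → i = j) →
        SparseCode.ldgmAvgCorr (W ε) G i j ≤ 16 * Real.exp (-(d : ℝ) / (g ε)⁻¹) := fun hij => by
      have := hdecay ε h1 h2 n m G hG i j d hd hij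
      rwa [div_inv_eq_mul, neg_mul, mul_comm (d : ℝ), ← neg_mul]
    refine ⟨hfirst, ?_⟩
    by_cases hij : G.checkNbhd i = G.checkNbhd j
    · exact SparseCode.ldgmAvgCorr_le_of_nbhd_eq (W ε) G hd hij (le_max_right _ _)
    · refine (hfirst fun h => absurd h hij).trans ?_
      have hg := inv_pos.2 (hpos ε h1 h2)
      have : (d : ℝ) / max (g ε)⁻¹ 1 ≤ (d : ℝ) / (g ε)⁻¹ :=
        div_le_div_of_nonneg_left (Nat.cast_nonneg d) hg (le_max_left _ _)
      have : Real.exp (-(d : ℝ) / (g ε)⁻¹) ≤ Real.exp (-(d : ℝ) / max (g ε)⁻¹ 1) := by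
        rw [neg_div, neg_div]
        exact Real.exp_le_exp.2 (by linarith)
      linarith
  · obtain ⟨εp, h0, hmax, g, hpos, hanti, hlim, hdecay⟩ := hW.exists_ldpc_rate lmax kmax
    refine ⟨εp, h0, hmax, fun ε => (g ε)⁻¹, fun ε h1 h2 => inv_pos.2 (hpos ε h1 h2),
      by simpa only [inv_inv] using hanti, by simpa only [inv_inv] using hlim, ?_⟩
    intro ε h1 h2 n m G hG i j d hd
    have := hdecay ε h1 h2 n m G hG i j d hd
    rwa [div_inv_eq_mul, neg_mul, mul_comm (d : ℝ), ← neg_mul]
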